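/- **Proposition (Euler–Lagrange equation for drops).** A *drop of class $H^2$* is a map $\gamma\in H^2((0,1);\mathbb{R}^2)$ (identified with its $C^1([0,1])$ representative) that is regular, i.e. $\partial_x\gamma(x)\neq 0$ for every $x\in[0,1]$, and satisfies $\gamma(0)=\gamma(1)$. Along a regular curve put $\partial_s=|\partial_x\gamma|^{-1}\partial_x$, $\tau=\partial_s\gamma$, let $\nu$ be the counter-clockwise rotation of $\tau$ by $\pi/2$, let $\boldsymbol\kappa=\partial_s\tau=k\nu$ with $k$ the signed curvature, and for vector fields $\phi$ put $\partial_s^{\perp}\phi=\partial_s\phi-\langle\partial_s\phi,\tau\rangle\tau$. Let $$F(\gamma)=E(\gamma)+L(\gamma)=\int_0^1 k^2\,|\partial_x\gamma|\,dx+\int_0^1|\partial_x\gamma|\,dx .$$ Let $\gamma$ be a drop of class $H^2$ that is stationary for $F$, i.e. $\frac{d}{dt}F(\gamma+t\psi)\big|_{t=0}=0$ for every $\psi\in C^\infty([0,1];\mathbb{R}^2)$ with $\psi(0)=\psi(1)$. Then the curve is of class $C^\infty$: there are a regular $\eta\in C^\infty([0,1];\mathbb{R}^2)$ and an orientation-preserving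 $C^1$ diffeomorphism $\varphi$ of $[0,1]$ with $\gamma=\eta\circ\varphi$ on $[0,1]$. Moreover, for every such parametrization $\eta$, with $\partial_s$, $\partial_s^\perp$, $\boldsymbol\kappa$ and $k$ computed along $\eta$, $$2(\partial_s^{\perp})^2\boldsymbol\kappa+|\boldsymbol\kappa|^2\boldsymbol\kappa-\boldsymbol\kappa=0\quad\text{on }(0,1),\qquad 2\,\partial_s^2k+k^3-k=0\quad\text{on }[0,1],$$ together with the boundary conditions $$k(0)=k(1)=0\quad\text{and}\quad \partial_sk(0)=\partial_sk(1)\ \text{ or }\ \partial_sk(0)=-\partial_sk(1).$$ -/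

import Mathlib

open Set MeasureTheory
open scoped ContDiff

namespace ElasticDrop

/-- The Euclidean plane. -/
abbrev Plane : Type := EuclideanSpace ℝ (Fin 2)

/-- The counter-clockwise rotation by `π / 2`. -/
noncomputable def rot (v : Plane) : Plane := !₂[-(v 1), v 0]

/-- `g` is the weak (distributional) derivative of `f` on the open interval `(0,1)`. -/
def HasWeakDeriv (f g : ℝ → Plane) : Prop :=
  ∀ φ : ℝ → ℝ, ContDiff ℝ ∞ φ → HasCompactSupport φ → tsupport φ ⊆ Ioo 0 1 →
    ∫ x in Ioo (0 : ℝ) 1, deriv φ x • f x = - ∫ x in Ioo (0 : ℝ) 1, φ x • g x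

/-- `γ : [0,1] → ℝ²` is (the continuous representative of) an element of the Sobolev space
`H²((0,1); ℝ²)`. Only the values of `γ` on `[0,1]` matter. -/
def IsH2 (γ : ℝ → Plane) : Prop :=
  ContinuousOn γ (Icc 0 1) ∧
    ∃ g₁ g₂ : ℝ → Plane,
      MemLp g₁ 2 (volume.restrict (Ioo (0 : ℝ) 1)) ∧
      MemLp g₂ 2 (volume.restrict (Ioo (0 : ℝ) 1)) ∧
      HasWeakDeriv γ g₁ ∧ HasWeakDeriv g₁ g₂

/-- The derivative `∂ₓ f` on `[0,1]` (one-sided at the end points). -/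
noncomputable def dx (f : ℝ → Plane) (x : ℝ) : Plane := derivWithin f (Icc 0 1) x

/-- A curve is regular if `∂ₓ γ` vanishes nowhere on `[0,1]`. -/
def IsRegular (γ : ℝ → Plane) : Prop := ∀ x ∈ Icc (0 : ℝ) 1, dx γ x ≠ 0

/-- The arclength derivative `∂ₛ = |∂ₓ γ|⁻¹ ∂ₓ` along `γ`, for vector fields and functions. -/
noncomputable def ds {V : Type*} [NormedAddCommGroup V] [NormedSpace ℝ V]
    (γ : ℝ → Plane) (f : ℝ → V) (x : ℝ) : V :=
  ‖dx γ x‖⁻¹ • derivWithin f (Icc 0 1) x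

/-- The unit tangent vector `τ = ∂ₛ γ`. -/
noncomputable def tangent (γ : ℝ → Plane) : ℝ → Plane := ds γ γ

/-- The unit normal vector, the counter-clockwise rotation of the tangent by `π / 2`. -/
noncomputable def normal (γ : ℝ → Plane) (x : ℝ) : Plane := rot (tangent γ x)

/-- The curvature vector `κ = ∂ₛ τ`. For a regular curve of class `H²` the field `τ` is absolutely
continuous, so that `κ x` exists for almost every `x` and is also the weak derivative of `τ`. -/
noncomputable def curvatureVector (γ : ℝ → Plane) : ℝ → Plane := ds γ (tangent γ)

/-- The (signed) scalar curvature `k`, determined by `κ = k ν`. -/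
noncomputable def curvature (γ : ℝ → Plane) (x : ℝ) : ℝ :=
  inner ℝ (curvatureVector γ x) (normal γ x)

/-- The normal component `∂ₛ^⊥` of the arclength derivative of a vector field along `γ`. -/
noncomputable def dsPerp (γ : ℝ → Plane) (f : ℝ → Plane) (x : ℝ) : Plane :=
  ds γ f x - (inner ℝ (ds γ f x) (tangent γ x) : ℝ) • tangent γ x

/-- The elastic energy `E(γ) = ∫_γ k² ds`. -/
noncomputable def elasticEnergy (γ : ℝ → Plane) : ℝ :=
  ∫ x in (0 : ℝ)..1, curvature γ x ^ 2 * ‖dx γ x‖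

/-- The length `L(γ) = ∫_γ 1 ds`. -/
noncomputable def length (γ : ℝ → Plane) : ℝ := ∫ x in (0 : ℝ)..1, ‖dx γ x‖

/-- The penalised energy `F = E + L`. -/
noncomputable def energy (γ : ℝ → Plane) : ℝ := elasticEnergy γ + length γ

/-- A drop of class `H²`: a regular `H²` curve whose end points coincide. -/
structure IsDrop (γ : ℝ → Plane) : Prop where
  isH2 : IsH2 γ
  regular : IsRegular γ
  endpoints : γ 0 = γ 1

/-- Stationarity of a drop for `F`: the first variation vanishes in the direction of every smooth
`ψ : [0,1] → ℝ²` with `ψ(0) = ψ(1)` (so that `γ + t ψ` is again a drop for small `|t|`). -/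
def IsStationary (γ : ℝ → Plane) : Prop :=
  ∀ ψ : ℝ → Plane, ContDiffOn ℝ ∞ ψ (Icc 0 1) → ψ 0 = ψ 1 →
    HasDerivAt (fun t : ℝ => energy (fun x => γ x + t • ψ x)) 0 0

/-- `φ` is an orientation-preserving `C¹` diffeomorphism of `[0,1]`. -/
structure IsParamChange (φ : ℝ → ℝ) : Prop where
  contDiffOn : ContDiffOn ℝ 1 φ (Icc 0 1)
  deriv_pos : ∀ x ∈ Icc (0 : ℝ) 1, 0 < derivWithin φ (Icc 0 1) x
  map_zero : φ 0 = 0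
  map_one : φ 1 = 1

/-- `η` is a regular `C^∞` parametrization on `[0,1]` of the curve parametrized by `γ`. -/
structure IsSmoothParametrization (γ η : ℝ → Plane) : Prop where
  smooth : ContDiffOn ℝ ∞ η (Icc 0 1)
  regular : IsRegular η
  reparam : ∃ φ : ℝ → ℝ, IsParamChange φ ∧ ∀ x ∈ Icc (0 : ℝ) 1, γ x = η (φ x)

end ElasticDrop

/-! An `H²` curve is `C¹` with absolutely continuous derivative `v` and `v' = w ∈ L²`. In these
terms the bending density is `|v|⁻⁵ ⟨w, rot v⟩²`, and differentiation under the integral gives a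
first variation `∫ ⟨ψ'', A⟩ + ⟨ψ', B⟩`. Only `U = ψ'` enters, subject to `∫ U = 0`. The multiplier
of this constraint is the vector `c = ∫ B`, and stationarity reads `A = ∫₀ˣ (B - c)` almost
everywhere. The right side vanishes at both ends, since `U` is free there: this is the natural
condition `k(0) = k(1) = 0`.

Since `|v| A = 2kν`, the curvature has a continuous representative `K`, and the weak equation
becomes the first-order system `∂ₛτ = Kν`, `∂ₛ(2Kν) = (1 - 3K²)τ - c`, recorded in `IsElastica`.
This system is invariant under `C¹` changes of parameter. At constant speed it bootstraps to
smoothness, which yields `η`; for any other smooth parametrization it holds by invariance.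

The remaining claims are algebra. The normal component of the second equation is `2∂ₛK = -⟨c, ν⟩`,
and the tangential one is the conservation law `K² + ⟨c, τ⟩ = 1`; one more derivative gives `2∂ₛ²K +
K³ - K = 0`. At an end `K = 0`, so `⟨c, τ⟩ = 1` and `4(∂ₛK)² = |c|² - 1`. The two end values of
`∂ₛK` thus agree up to sign. -/

namespace ElasticDrop

/-! ### Absolutely continuous vector-valued functions on `[0,1]`. -/

section AbsolutelyContinuous

theorem absolutelyContinuous_of_dist_le {X Y : Type*} [PseudoMetricSpace X] [PseudoMetricSpace Y]
    {f : ℝ → X} {g : ℝ → Y} {a b : ℝ} (C : ℝ) (hg : AbsolutelyContinuousOnInterval g a b)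
    (h : ∀ x ∈ uIcc a b, ∀ y ∈ uIcc a b, dist (f x) (f y) ≤ C * dist (g x) (g y)) :
    AbsolutelyContinuousOnInterval f a b := by
  unfold AbsolutelyContinuousOnInterval at hg ⊢
  refine squeeze_zero' (Filter.Eventually.of_forall fun E ↦ Finset.sum_nonneg fun i _ ↦ dist_nonneg)
    ?_ (by simpa using hg.const_mul C)
  rw [Filter.eventually_inf_principal]
  filter_upwards with E hE
  rw [Finset.mul_sum]
  exact Finset.sum_le_sum fun i hi ↦ h _ (hE.1 i hi).1 _ (hE.1 i hi).2

variable {E : Type*} [NormedAddCommGroup E] [NormedSpace ℝ E]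

/-- Increments of the primitive of `g` are dominated by those of the primitive of `‖g‖`, which
reduces the vector case to the real one. -/
theorem absolutelyContinuous_primitive {g : ℝ → E} {a b : ℝ}
    (hg : IntervalIntegrable g volume a b) :
    AbsolutelyContinuousOnInterval (fun x ↦ ∫ t in a..x, g t) a b := by
  have hn := hg.norm.absolutelyContinuousOnInterval_intervalIntegral (c := a) left_mem_uIcc
  refine absolutelyContinuous_of_dist_le 1 hn fun x hx y hy ↦ ?_
  have hi : ∀ z ∈ uIcc a b, IntervalIntegrable g volume a z := fun z hz ↦
    hg.mono_set (uIcc_subset_uIcc left_mem_uIcc hz)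
  rw [one_mul, dist_eq_norm, Real.dist_eq,
    intervalIntegral.integral_interval_sub_left (hi x hx) (hi y hy),
    intervalIntegral.integral_interval_sub_left (hi x hx).norm (hi y hy).norm]
  exact intervalIntegral.norm_integral_le_abs_integral_norm

/-- `f` is absolutely continuous on `[0,1]` with almost everywhere derivative `g`. -/
structure IsAC (f g : ℝ → E) : Prop where
  ac : AbsolutelyContinuousOnInterval f 0 1
  deriv : ∀ᵐ x, x ∈ Ioo (0 : ℝ) 1 → HasDerivAt f (g x) x

namespace IsAC

theorem continuousOn {f g : ℝ → E} (h : IsAC f g) : ContinuousOn f (Icc 0 1) := by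
  simpa using h.ac.continuousOn

theorem congr_deriv {f g g' : ℝ → E} (h : IsAC f g)
    (hg : ∀ᵐ x, x ∈ Ioo (0 : ℝ) 1 → g x = g' x) : IsAC f g' where
  ac := h.ac
  deriv := by
    filter_upwards [h.deriv, hg] with x h1 h2 hx
    exact h2 hx ▸ h1 hx

theorem congr {f g f' : ℝ → E} (h : IsAC f g) (hf : ∀ x ∈ Icc (0 : ℝ) 1, f x = f' x) :
    IsAC f' g where
  ac := by
    refine absolutelyContinuous_of_dist_le 1 h.ac fun x hx y hy ↦ ?_
    rw [uIcc_of_le zero_le_one] at hx hy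
    rw [one_mul, hf x hx, hf y hy]
  deriv := by
    filter_upwards [h.deriv] with x h1 hx
    refine (h1 hx).congr_of_eventuallyEq ?_
    filter_upwards [isOpen_Ioo.mem_nhds hx] with y hy
    exact (hf y (Ioo_subset_Icc_self hy)).symm

theorem sub {f g f' g' : ℝ → E} (h : IsAC f g) (h' : IsAC f' g') :
    IsAC (fun x ↦ f x - f' x) (fun x ↦ g x - g' x) where
  ac := h.ac.fun_sub h'.ac
  deriv := by
    filter_upwards [h.deriv, h'.deriv] with x h1 h2 hx
    exact (h1 hx).sub (h2 hx)

theorem smul {φ φ' : ℝ → ℝ} {f g : ℝ → E} (hφ : IsAC φ φ') (h : IsAC f g) :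
    IsAC (fun x ↦ φ x • f x) (fun x ↦ φ x • g x + φ' x • f x) where
  ac := hφ.ac.fun_smul h.ac
  deriv := by
    filter_upwards [hφ.deriv, h.deriv] with x h1 h2 hx
    exact (h1 hx).smul (h2 hx)

theorem of_contDiff {f : ℝ → E} (hf : ContDiff ℝ 1 f) : IsAC f (_root_.deriv f) where
  ac := hf.contDiffOn.absolutelyContinuousOnInterval
  deriv := Filter.Eventually.of_forall fun _ _ ↦
    ((hf.differentiable one_ne_zero) _).hasDerivAt

theorem primitive [CompleteSpace E] {g : ℝ → E} (hg : IntervalIntegrable g volume 0 1) (c : E) :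
    IsAC (fun x ↦ c + ∫ t in (0 : ℝ)..x, g t) g where
  ac := by
    refine absolutelyContinuous_of_dist_le 1 (absolutelyContinuous_primitive hg) fun x _ y _ ↦ ?_
    simp
  deriv := by
    filter_upwards [hg.ae_hasDerivAt_integral] with x hx hx'
    exact (hx (by simpa using Ioo_subset_Icc_self hx') 0 (by simp)).const_add c

/-- The fundamental theorem of calculus for absolutely continuous vector fields. -/
theorem eq_add_integral [CompleteSpace E] {f g : ℝ → E} (h : IsAC f g)
    (hg : IntervalIntegrable g volume 0 1) {x : ℝ} (hx : x ∈ Icc (0 : ℝ) 1) :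
    f x = f 0 + ∫ t in (0 : ℝ)..x, g t := by
  have h0 := h.sub (primitive hg (f 0))
  obtain ⟨C, hC⟩ := h0.ac.const_of_ae_hasDerivAt_zero (by
    have e0 : ∀ᵐ x : ℝ, x ≠ 0 := by simp [ae_iff]
    have e1 : ∀ᵐ x : ℝ, x ≠ 1 := by simp [ae_iff]
    filter_upwards [h0.deriv, e0, e1] with y hy h0 h1 hy'
    rw [uIcc_of_le zero_le_one] at hy'
    simpa using hy ⟨lt_of_le_of_ne hy'.1 h0.symm, lt_of_le_of_ne hy'.2 h1⟩)
  have h1 := hC x (by simpa using hx)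
  have h2 := hC 0 (by simp)
  simp only [intervalIntegral.integral_same, add_zero, sub_self] at h2
  rw [← h2] at h1
  exact sub_eq_zero.mp h1

/-- The passage from almost everywhere to everywhere, end points included: once the a.e. derivative
has a continuous representative, the fundamental theorem of calculus applies pointwise. -/
theorem hasDerivWithinAt [CompleteSpace E] {f g : ℝ → E} (h : IsAC f g)
    (hg : ContinuousOn g (Icc 0 1)) {x : ℝ} (hx : x ∈ Icc (0 : ℝ) 1) :
    HasDerivWithinAt f (g x) (Icc 0 1) x := by
  have hi : IntervalIntegrable g volume 0 1 :=
    ContinuousOn.intervalIntegrable (by rwa [uIcc_of_le zero_le_one])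
  have : Fact (x ∈ Icc (0 : ℝ) 1) := ⟨hx⟩
  have h1 : HasDerivWithinAt (fun x ↦ ∫ t in (0 : ℝ)..x, g t) (g x) (Icc 0 1) x :=
    intervalIntegral.integral_hasDerivWithinAt_right
      (hi.mono_set (uIcc_subset_uIcc left_mem_uIcc (by simpa using hx)))
      (hg.stronglyMeasurableAtFilter_nhdsWithin measurableSet_Icc x) (hg x hx)
  exact (h1.const_add (f 0)).congr (fun y hy ↦ h.eq_add_integral hi hy) (h.eq_add_integral hi hx)

theorem norm_of_ne_zero {E : Type*} [NormedAddCommGroup E] [InnerProductSpace ℝ E]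
    {v w : ℝ → E} (h : IsAC v w) (h0 : ∀ x ∈ Icc (0 : ℝ) 1, v x ≠ 0) :
    IsAC (fun x ↦ ‖v x‖) (fun x ↦ ‖v x‖⁻¹ * inner ℝ (v x) (w x)) where
  ac := by
    refine absolutelyContinuous_of_dist_le 1 h.ac fun x _ y _ ↦ ?_
    rw [one_mul]
    exact dist_norm_norm_le _ _ |>.trans (dist_eq_norm _ _).ge
  deriv := by
    filter_upwards [h.deriv] with x h1 hx
    have h2 := h0 x (Ioo_subset_Icc_self hx)
    have h3 : HasDerivAt (fun x ↦ Real.sqrt (‖v x‖ ^ 2)) _ x :=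
      ((h1 hx).norm_sq).sqrt (by simpa using h2)
    simp only [Real.sqrt_sq (norm_nonneg _)] at h3
    convert! h3 using 1
    field_simp

theorem inv_of_pos {f g : ℝ → ℝ} (h : IsAC f g) (h0 : ∀ x ∈ Icc (0 : ℝ) 1, 0 < f x) :
    IsAC (fun x ↦ (f x)⁻¹) (fun x ↦ -g x / f x ^ 2) where
  ac := by
    -- Inversion is Lipschitz on `[m, ∞)` with constant `m⁻²`, where `m` is the minimum `f z`.
    obtain ⟨z, hz, hmin⟩ := isCompact_Icc.exists_isMinOn (nonempty_Icc.mpr zero_le_one)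
      h.continuousOn
    refine absolutelyContinuous_of_dist_le ((f z) ^ 2)⁻¹ h.ac fun x hx y hy ↦ ?_
    rw [uIcc_of_le zero_le_one] at hx hy
    have px := h0 x hx
    have py := h0 y hy
    have pz := h0 z hz
    have e : (f x)⁻¹ - (f y)⁻¹ = (f x * f y)⁻¹ * (f y - f x) := by field_simp
    rw [Real.dist_eq, Real.dist_eq, e, abs_mul, abs_sub_comm (f y), abs_of_pos (by positivity)]
    gcongr
    rw [sq]
    exact mul_le_mul (hmin hx) (hmin hy) pz.le px.le
  deriv := by
    filter_upwards [h.deriv] with x h1 hx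
    exact (h1 hx).inv (h0 x (Ioo_subset_Icc_self hx)).ne'

end IsAC

end AbsolutelyContinuous

/-! ### Weak derivatives and the regularity of `H²` curves. -/

section WeakDerivative

theorem deriv_primitive {ζ : ℝ → ℝ} (hζ : Continuous ζ) (x : ℝ) :
    HasDerivAt (fun x ↦ ∫ t in (0 : ℝ)..x, ζ t) (ζ x) x :=
  intervalIntegral.integral_hasDerivAt_right (hζ.intervalIntegrable _ _)
      (hζ.stronglyMeasurableAtFilter _ _) hζ.continuousAt

theorem contDiff_primitive {ζ : ℝ → ℝ} (hζ : ContDiff ℝ ∞ ζ) :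
    ContDiff ℝ ∞ (fun x ↦ ∫ t in (0 : ℝ)..x, ζ t) := by
  have hd := deriv_primitive hζ.continuous
  rw [contDiff_infty_iff_deriv]
  refine ⟨fun x ↦ (hd x).differentiableAt, ?_⟩
  rwa [funext fun x ↦ (hd x).deriv]

/-- The primitive from `0` vanishes to the left of the support of `ζ`, and zero mean makes it vanish
to the right as well. -/
theorem exists_test_primitive {ζ : ℝ → ℝ} (hζ : ContDiff ℝ ∞ ζ) (hc : HasCompactSupport ζ)
    (hs : tsupport ζ ⊆ Ioo 0 1) (h0 : ∫ x in (0 : ℝ)..1, ζ x = 0) :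
    ∃ φ : ℝ → ℝ, ContDiff ℝ ∞ φ ∧ HasCompactSupport φ ∧ tsupport φ ⊆ Ioo 0 1 ∧ deriv φ = ζ := by
  obtain ⟨a, b, ha, hb, hab⟩ : ∃ a b : ℝ, 0 < a ∧ b < 1 ∧ tsupport ζ ⊆ Icc a b := by
    rcases (tsupport ζ).eq_empty_or_nonempty with he | hne
    · exact ⟨1 / 2, 1 / 2, by norm_num, by norm_num, by simp [he]⟩
    · obtain ⟨a, ha⟩ := hc.isCompact.exists_isLeast hne
      obtain ⟨b, hb⟩ := hc.isCompact.exists_isGreatest hne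
      exact ⟨a, b, (hs ha.1).1, (hs hb.1).2, fun x hx ↦ ⟨ha.2 hx, hb.2 hx⟩⟩
  have hz : ∀ x, x ∉ Icc a b → ζ x = 0 := fun x hx ↦
    image_eq_zero_of_notMem_tsupport fun h ↦ hx (hab h)
  have hsupp : Function.support (fun x ↦ ∫ t in (0 : ℝ)..x, ζ t) ⊆ Icc a b := by
    intro x hx
    by_contra hx'
    refine hx ?_
    rw [mem_Icc, not_and_or, not_le, not_le] at hx'
    rcases hx' with h | h
    · refine intervalIntegral.integral_zero_ae (Filter.Eventually.of_forall fun t ht ↦ hz t ?_)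
      intro ht'
      have := ht.2
      have : max 0 x < a := max_lt ha h
      linarith [ht'.1]
    · show ∫ t in (0 : ℝ)..x, ζ t = 0
      rw [← intervalIntegral.integral_add_adjacent_intervals
        (hζ.continuous.intervalIntegrable 0 1) (hζ.continuous.intervalIntegrable 1 x), h0, zero_add]
      refine intervalIntegral.integral_zero_ae (Filter.Eventually.of_forall fun t ht ↦ hz t ?_)
      intro ht'
      have := ht.1
      have : b < min 1 x := lt_min hb h
      linarith [ht'.2]
  refine ⟨_, contDiff_primitive hζ, HasCompactSupport.of_support_subset_isCompact isCompact_Icc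
    hsupp, ?_, funext fun x ↦ (deriv_primitive hζ.continuous x).deriv⟩
  exact (closure_minimal hsupp isClosed_Icc).trans fun x hx ↦
    ⟨ha.trans_le hx.1, hx.2.trans_lt hb⟩

theorem integral_Ioo_eq {E : Type*} [NormedAddCommGroup E] [NormedSpace ℝ E] (f : ℝ → E) :
    ∫ x in Ioo (0 : ℝ) 1, f x = ∫ x in (0 : ℝ)..1, f x := by
  rw [intervalIntegral.integral_of_le zero_le_one, integral_Ioc_eq_integral_Ioo]

theorem intervalIntegrable_iff_Ioo {E : Type*} [NormedAddCommGroup E] {f : ℝ → E} :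
    IntervalIntegrable f volume 0 1 ↔ Integrable f (volume.restrict (Ioo (0 : ℝ) 1)) := by
  rw [intervalIntegrable_iff_integrableOn_Ioo_of_le zero_le_one, IntegrableOn]

theorem integral_deriv_smul_add {E : Type*} [NormedAddCommGroup E] [NormedSpace ℝ E]
    [CompleteSpace E] {φ : ℝ → ℝ} (hφ : ContDiff ℝ 1 φ) {f g : ℝ → E} (h : IsAC f g)
    (hg : IntervalIntegrable g volume 0 1) :
    ∫ x in (0 : ℝ)..1, deriv φ x • f x = φ 1 • f 1 - φ 0 • f 0 - ∫ x in (0 : ℝ)..1, φ x • g x := by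
  have hi1 : IntervalIntegrable (fun x ↦ φ x • g x) volume 0 1 :=
    hg.continuousOn_smul hφ.continuous.continuousOn
  have hi2 : IntervalIntegrable (fun x ↦ deriv φ x • f x) volume 0 1 := by
    apply ContinuousOn.intervalIntegrable
    rw [uIcc_of_le zero_le_one]
    exact (hφ.continuous_deriv le_rfl).continuousOn.smul h.continuousOn
  have := ((IsAC.of_contDiff hφ).smul h).eq_add_integral (hi1.add hi2) (right_mem_Icc.mpr zero_le_one)
  rw [intervalIntegral.integral_add hi1 hi2] at this
  rw [this]
  abel

theorem integral_eq_setIntegral_of_tsupport {E : Type*} [NormedAddCommGroup E] [NormedSpace ℝ E]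
    {ζ : ℝ → ℝ} (hs : tsupport ζ ⊆ Ioo 0 1) (f : ℝ → E) :
    ∫ x, ζ x • f x = ∫ x in (0 : ℝ)..1, ζ x • f x := by
  rw [← integral_Ioo_eq, setIntegral_eq_integral_of_forall_compl_eq_zero]
  intro x hx
  rw [image_eq_zero_of_notMem_tsupport fun h ↦ hx (hs h), zero_smul]

/-- The lemma of du Bois-Reymond. -/
theorem HasWeakDeriv.exists_ae_eq {f g : ℝ → Plane} (h : HasWeakDeriv f g)
    (hf : IntervalIntegrable f volume 0 1) (hg : IntervalIntegrable g volume 0 1) :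
    ∃ c : Plane, ∀ᵐ x, x ∈ Ioo (0 : ℝ) 1 → f x = c + ∫ t in (0 : ℝ)..x, g t := by
  set H : ℝ → Plane := fun x ↦ ∫ t in (0 : ℝ)..x, g t with hH
  have hHac : IsAC H g := by simpa using IsAC.primitive hg 0
  have hHi : IntervalIntegrable H volume 0 1 := by
    apply ContinuousOn.intervalIntegrable
    rw [uIcc_of_le zero_le_one]
    exact hHac.continuousOn
  have hi : IntervalIntegrable (fun x ↦ f x - H x) volume 0 1 := hf.sub hHi
  have key : ∀ φ : ℝ → ℝ, ContDiff ℝ ∞ φ → HasCompactSupport φ → tsupport φ ⊆ Ioo 0 1 →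
      ∫ x in (0 : ℝ)..1, deriv φ x • (f x - H x) = 0 := by
    intro φ h1 h2 h3
    have h1' : ContDiff ℝ 1 φ := h1.of_le (by simp)
    have e1 := h φ h1 h2 h3
    have e2 := integral_deriv_smul_add h1' hHac hg
    have z0 : φ 0 = 0 := image_eq_zero_of_notMem_tsupport fun h ↦ by simpa using h3 h
    have z1 : φ 1 = 0 := image_eq_zero_of_notMem_tsupport fun h ↦ by simpa using h3 h
    rw [z0, z1, zero_smul, zero_smul, sub_zero, zero_sub] at e2
    rw [integral_Ioo_eq, integral_Ioo_eq] at e1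
    have hc := (h1'.continuous_deriv le_rfl).continuousOn (s := uIcc (0 : ℝ) 1)
    simp_rw [smul_sub]
    rw [intervalIntegral.integral_sub (hf.continuousOn_smul hc) (hHi.continuousOn_smul hc), e1, e2,
      sub_self]
  -- Any fixed test function of unit mass would do. Subtracting `m θ` from a test function of mass
  -- `m` leaves zero mean, hence a derivative of a test function; the constant sought is the
  -- `θ`-average of `f - H`.
  let θ₀ : ContDiffBump (1 / 2 : ℝ) := ⟨1 / 8, 1 / 4, by norm_num, by norm_num⟩
  let θ : ℝ → ℝ := θ₀.normed volume
  have hθ : ContDiff ℝ ∞ θ := θ₀.contDiff_normed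
  have hθc : HasCompactSupport θ := θ₀.hasCompactSupport_normed
  have hθs : tsupport θ ⊆ Ioo 0 1 := by
    rw [θ₀.tsupport_normed_eq]
    intro x hx
    rw [Real.closedBall_eq_Icc] at hx
    have h1 := hx.1
    have h2 := hx.2
    simp only [θ₀] at h1 h2
    constructor <;> linarith
  have hθ1 : ∫ x in (0 : ℝ)..1, θ x = 1 := by
    have := integral_eq_setIntegral_of_tsupport hθs (fun _ ↦ (1 : ℝ))
    simp only [smul_eq_mul, mul_one] at this
    rw [← this]
    exact θ₀.integral_normed
  set c := ∫ x in (0 : ℝ)..1, θ x • (f x - H x) with hcdef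
  refine ⟨c, ?_⟩
  have hz := isOpen_Ioo.ae_eq_zero_of_integral_contDiff_smul_eq_zero (U := Ioo (0 : ℝ) 1)
    (μ := volume) (f := fun x ↦ f x - H x - c)
    (IntegrableOn.locallyIntegrableOn
      (intervalIntegrable_iff_Ioo.mp (hi.sub intervalIntegrable_const))) ?_
  · filter_upwards [hz] with x hx hx'
    rw [← sub_eq_zero, ← hx hx']
    abel
  · intro ζ h1 h2 h3
    rw [integral_eq_setIntegral_of_tsupport h3]
    set m := ∫ x in (0 : ℝ)..1, ζ x with hm
    have hs : tsupport (fun x ↦ ζ x - m * θ x) ⊆ tsupport ζ ∪ tsupport θ := by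
      refine closure_minimal (fun x hx ↦ ?_) ((isClosed_tsupport _).union (isClosed_tsupport _))
      by_contra hx'
      rw [mem_union, not_or] at hx'
      refine hx ?_
      simp [image_eq_zero_of_notMem_tsupport hx'.1, image_eq_zero_of_notMem_tsupport hx'.2]
    obtain ⟨φ, f1, f2, f3, f4⟩ := exists_test_primitive (ζ := fun x ↦ ζ x - m * θ x)
      (h1.sub (contDiff_const.mul hθ))
      ((h2.isCompact.union hθc.isCompact).of_isClosed_subset (isClosed_tsupport _) hs)
      (hs.trans (union_subset h3 hθs)) (by
        rw [intervalIntegral.integral_sub (h1.continuous.intervalIntegrable _ _)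
          ((hθ.continuous.intervalIntegrable _ _).const_mul _),
          intervalIntegral.integral_const_mul, hθ1, ← hm]
        ring)
    have := key φ f1 f2 f3
    rw [f4] at this
    have hcζ : ContinuousOn ζ (uIcc (0 : ℝ) 1) := h1.continuous.continuousOn
    have hcθ : ContinuousOn θ (uIcc (0 : ℝ) 1) := hθ.continuous.continuousOn
    simp_rw [sub_smul, mul_smul] at this
    rw [intervalIntegral.integral_sub (hi.continuousOn_smul hcζ)
      (g := fun x ↦ m • θ x • (f x - H x)) ((hi.continuousOn_smul hcθ).smul m), intervalIntegral.integral_smul, ← hcdef] at this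
    simp_rw [smul_sub _ _ c]
    rw [intervalIntegral.integral_sub (hi.continuousOn_smul hcζ)
      (intervalIntegrable_const.continuousOn_smul hcζ), intervalIntegral.integral_smul_const, ← hm]
    exact this

theorem eqOn_of_ae_eq {E : Type*} [NormedAddCommGroup E] {f g : ℝ → E}
    (hf : ContinuousOn f (Icc 0 1)) (hg : ContinuousOn g (Icc 0 1))
    (h : ∀ᵐ x, x ∈ Ioo (0 : ℝ) 1 → f x = g x) : ∀ x ∈ Icc (0 : ℝ) 1, f x = g x := by
  refine Measure.eqOn_Icc_of_ae_eq volume zero_ne_one ?_ hf hg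
  rw [← restrict_Ioo_eq_restrict_Icc]
  exact (ae_restrict_iff' measurableSet_Ioo).mpr h

/-- An `H²` curve is `C¹`, with absolutely continuous derivative. -/
theorem IsH2.exists_isAC {γ : ℝ → Plane} (h : IsH2 γ) :
    ∃ v w : ℝ → Plane, MemLp w 2 (volume.restrict (Ioo (0 : ℝ) 1)) ∧ IsAC v w ∧
      ∀ x ∈ Icc (0 : ℝ) 1, HasDerivWithinAt γ (v x) (Icc 0 1) x := by
  obtain ⟨hc, g₁, g₂, h1, h2, h3, h4⟩ := h
  have i1 : IntervalIntegrable g₁ volume 0 1 :=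
    intervalIntegrable_iff_Ioo.mpr (h1.integrable (by norm_num))
  have i2 : IntervalIntegrable g₂ volume 0 1 :=
    intervalIntegrable_iff_Ioo.mpr (h2.integrable (by norm_num))
  have i0 : IntervalIntegrable γ volume 0 1 :=
    ContinuousOn.intervalIntegrable (by rwa [uIcc_of_le zero_le_one])
  obtain ⟨c, hc0⟩ := h3.exists_ae_eq i0 i1
  obtain ⟨d, hd⟩ := h4.exists_ae_eq i1 i2
  have hv := IsAC.primitive i2 d
  set v : ℝ → Plane := fun x ↦ d + ∫ t in (0 : ℝ)..x, g₂ t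
  refine ⟨v, g₂, h2, hv, ?_⟩
  have iv : IntervalIntegrable v volume 0 1 :=
    ContinuousOn.intervalIntegrable (by rw [uIcc_of_le zero_le_one]; exact hv.continuousOn)
  have hγ : ∀ x ∈ Icc (0 : ℝ) 1, γ x = c + ∫ t in (0 : ℝ)..x, v t := by
    refine eqOn_of_ae_eq hc (IsAC.primitive iv c).continuousOn ?_
    filter_upwards [hc0] with x hx hx'
    rw [hx hx']
    congr 1
    refine intervalIntegral.integral_congr_ae ?_
    filter_upwards [hd] with t ht ht'
    rw [uIoc_of_le hx'.1.le] at ht'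
    exact ht ⟨ht'.1, ht'.2.trans_lt hx'.2⟩
  intro x hx
  refine ((IsAC.primitive iv c).hasDerivWithinAt hv.continuousOn hx).congr hγ (hγ x hx)

end WeakDerivative

/-! ### The rotation by `π / 2` and orthonormal frames. -/

section Rotation

theorem inner_plane (v w : Plane) : inner ℝ v w = v 0 * w 0 + v 1 * w 1 := by
  simp [PiLp.inner_apply, Fin.sum_univ_two, mul_comm]

@[simp] theorem rot_apply_zero (v : Plane) : rot v 0 = -v 1 := by simp [rot]

@[simp] theorem rot_apply_one (v : Plane) : rot v 1 = v 0 := by simp [rot]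

/-- The rotation by `π / 2` as a continuous linear map. -/
noncomputable def rotL : Plane →L[ℝ] Plane :=
  LinearMap.toContinuousLinearMap
    { toFun := rot
      map_add' := fun v w ↦ by ext i; fin_cases i <;> simp [add_comm]
      map_smul' := fun c v ↦ by ext i; fin_cases i <;> simp }

theorem rotL_apply (v : Plane) : rotL v = rot v := rfl

theorem rot_smul (c : ℝ) (v : Plane) : rot (c • v) = c • rot v := rotL.map_smul c v

theorem rot_rot (v : Plane) : rot (rot v) = -v := by ext i; fin_cases i <;> simp

theorem inner_rot_self (v : Plane) : inner ℝ v (rot v) = 0 := by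
  rw [inner_plane]; simp [mul_comm]

theorem inner_rot_left (v w : Plane) : inner ℝ (rot v) w = -inner ℝ v (rot w) := by
  rw [inner_plane, inner_plane]; simp

theorem norm_rot (v : Plane) : ‖rot v‖ = ‖v‖ := by
  rw [← sq_eq_sq₀ (norm_nonneg _) (norm_nonneg _), ← real_inner_self_eq_norm_sq,
    ← real_inner_self_eq_norm_sq, inner_rot_left, rot_rot, inner_neg_right, neg_neg]

theorem eq_inner_smul_add {τ : Plane} (h : ‖τ‖ = 1) (w : Plane) :
    w = (inner ℝ w τ : ℝ) • τ + (inner ℝ w (rot τ) : ℝ) • rot τ := by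
  have h1 : τ 0 * τ 0 + τ 1 * τ 1 = 1 := by
    rw [← inner_plane, real_inner_self_eq_norm_sq, h, one_pow]
  ext i
  fin_cases i
  · simp [inner_plane]; linear_combination (-w 0) * h1
  · simp [inner_plane]; linear_combination (-w 1) * h1

end Rotation

/-! ### Differentiating the energy along `γ + tψ`. -/

section FirstVariation

theorem uniqueDiffWithinAt_unitInterval {x : ℝ} (hx : x ∈ Icc (0 : ℝ) 1) :
    UniqueDiffWithinAt ℝ (Icc (0 : ℝ) 1) x :=
  uniqueDiffOn_Icc zero_lt_one x hx

theorem tangent_eq {β V : ℝ → Plane} (hβ : ∀ x ∈ Icc (0 : ℝ) 1, dx β x = V x) {x : ℝ}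
    (hx : x ∈ Icc (0 : ℝ) 1) : tangent β x = ‖V x‖⁻¹ • V x := by
  rw [tangent, ds, hβ x hx, ← hβ x hx, dx]

/-- The derivative of the factor `‖V‖⁻¹` only contributes a multiple of `V`, which is orthogonal to
`rot V`; its value is never needed. -/
theorem curvature_eq {β V : ℝ → Plane} (hβ : ∀ x ∈ Icc (0 : ℝ) 1, dx β x = V x) {x : ℝ}
    (hx : x ∈ Ioo (0 : ℝ) 1) {W : Plane} (hV : HasDerivAt V W x) (h0 : V x ≠ 0) :
    curvature β x = ‖V x‖⁻¹ ^ 3 * inner ℝ W (rot (V x)) := by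
  have hx' := Ioo_subset_Icc_self hx
  have h1 : DifferentiableAt ℝ (fun x ↦ ‖V x‖⁻¹) x :=
    (hV.differentiableAt.norm ℝ h0).inv (norm_ne_zero_iff.mpr h0)
  have h2 := (h1.hasDerivAt.smul hV).hasDerivWithinAt (s := Icc 0 1)
  have h3 := (h2.congr (fun y hy ↦ tangent_eq hβ hy) (tangent_eq hβ hx')).derivWithin
    (uniqueDiffWithinAt_unitInterval hx')
  rw [curvature, curvatureVector, ds, h3, hβ x hx', normal, tangent_eq hβ hx', rot_smul,
    inner_smul_left, inner_smul_right, inner_add_left, inner_smul_left, inner_smul_left,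
    inner_rot_self]
  simp
  ring

/-- The density of the elastic energy in terms of `∂ₓ γ = a` and `∂ₓ² γ = c`. -/
noncomputable def bend (a c : Plane) : ℝ := ‖a‖⁻¹ ^ 5 * inner ℝ c (rot a) ^ 2

/-- The derivative of `bend` at `(a, c)` in the direction `(b, d)`. -/
noncomputable def bendDeriv (a c b d : Plane) : ℝ :=
  2 * ‖a‖⁻¹ ^ 5 * inner ℝ c (rot a) * (inner ℝ d (rot a) + inner ℝ c (rot b)) -
    5 * ‖a‖⁻¹ ^ 7 * inner ℝ c (rot a) ^ 2 * inner ℝ a b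

theorem hasDerivAt_norm_line {a b : Plane} {t : ℝ} (h : a + t • b ≠ 0) :
    HasDerivAt (fun t : ℝ ↦ ‖a + t • b‖) (‖a + t • b‖⁻¹ * inner ℝ (a + t • b) b) t := by
  have h1 : HasDerivAt (fun t : ℝ ↦ a + t • b) b t := by
    simpa using ((hasDerivAt_id t).smul_const b).const_add a
  have h3 : HasDerivAt (fun t : ℝ ↦ Real.sqrt (‖a + t • b‖ ^ 2)) _ t :=
    (h1.norm_sq).sqrt (by simpa using h)
  simp only [Real.sqrt_sq (norm_nonneg _)] at h3
  convert! h3 using 1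
  field_simp

theorem hasDerivAt_bend_line {a b c d : Plane} {t : ℝ} (h : a + t • b ≠ 0) :
    HasDerivAt (fun t : ℝ ↦ bend (a + t • b) (c + t • d))
      (bendDeriv (a + t • b) (c + t • d) b d) t := by
  have h1 : HasDerivAt (fun t : ℝ ↦ rot (a + t • b)) (rot b) t := by
    have : HasDerivAt (fun t : ℝ ↦ a + t • b) b t := by
      simpa using ((hasDerivAt_id t).smul_const b).const_add a
    exact rotL.hasFDerivAt.comp_hasDerivAt t this
  have h2 : HasDerivAt (fun t : ℝ ↦ c + t • d) d t := by
    simpa using ((hasDerivAt_id t).smul_const d).const_add c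
  have h3 := (hasDerivAt_norm_line h).inv (norm_ne_zero_iff.mpr h)
  have h4 := (h3.pow 5).mul ((h2.inner ℝ h1).pow 2)
  have hn := norm_ne_zero_iff.mpr h
  refine h4.congr_deriv ?_
  simp only [bendDeriv, Pi.pow_apply, Pi.inv_apply, Nat.reduceSub]
  generalize ‖a + t • b‖ = n at hn ⊢
  field_simp
  push_cast
  ring

/-- Growth is only quadratic in the second-order data `c`, `d`, so an `L²` second derivative
provides an integrable majorant. -/
theorem abs_bendDeriv_le {a b c d : Plane} {R C D : ℝ} (hR : ‖a‖⁻¹ ≤ R) (ha : ‖a‖ ≤ C)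
    (hb : ‖b‖ ≤ C) (hc : ‖c‖ ≤ D) (hd : ‖d‖ ≤ D) :
    |bendDeriv a c b d| ≤ (4 * R ^ 5 * C ^ 2 + 5 * R ^ 7 * C ^ 4) * D ^ 2 := by
  have hR0 : 0 ≤ R := le_trans (by positivity) hR
  have hC0 : 0 ≤ C := (norm_nonneg _).trans ha
  have hD0 : 0 ≤ D := (norm_nonneg _).trans hc
  have e1 : |inner ℝ c (rot a)| ≤ D * C := (abs_real_inner_le_norm _ _).trans
    (by rw [norm_rot]; gcongr)
  have e2 : |inner ℝ d (rot a) + inner ℝ c (rot b)| ≤ 2 * (D * C) := by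
    refine (abs_add_le _ _).trans ?_
    rw [two_mul]
    refine add_le_add ((abs_real_inner_le_norm _ _).trans ?_)
      ((abs_real_inner_le_norm _ _).trans ?_) <;> rw [norm_rot] <;> gcongr
  have e3 : |inner ℝ a b| ≤ C * C := (abs_real_inner_le_norm _ _).trans (by gcongr)
  have hr : |‖a‖⁻¹| ≤ R := by rwa [abs_of_nonneg (by positivity)]
  unfold bendDeriv
  refine (abs_sub _ _).trans ?_
  simp only [abs_mul, abs_pow, Nat.abs_ofNat]
  calc _ ≤ 2 * R ^ 5 * (D * C) * (2 * (D * C)) + 5 * R ^ 7 * (D * C) ^ 2 * (C * C) := by gcongr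
    _ = _ := by ring

theorem aemeasurable_of_continuousOn {f : ℝ → Plane} (hf : ContinuousOn f (Icc 0 1)) :
    AEMeasurable f (volume.restrict (Ioo (0 : ℝ) 1)) :=
  (hf.mono Ioo_subset_Icc_self).aemeasurable measurableSet_Ioo

theorem aemeasurable_rot {f : ℝ → Plane} {μ : Measure ℝ} (hf : AEMeasurable f μ) :
    AEMeasurable (fun x ↦ rot (f x)) μ :=
  rotL.continuous.measurable.comp_aemeasurable hf

theorem aemeasurable_bend {a c : ℝ → Plane} {μ : Measure ℝ} (ha : AEMeasurable a μ)
    (hc : AEMeasurable c μ) : AEMeasurable (fun x ↦ bend (a x) (c x)) μ :=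
  (ha.norm.inv.pow_const 5).mul ((hc.inner (aemeasurable_rot ha)).pow_const 2)

theorem aemeasurable_bendDeriv {a c b d : ℝ → Plane} {μ : Measure ℝ} (ha : AEMeasurable a μ)
    (hc : AEMeasurable c μ) (hb : AEMeasurable b μ) (hd : AEMeasurable d μ) :
    AEMeasurable (fun x ↦ bendDeriv (a x) (c x) (b x) (d x)) μ :=
  ((((ha.norm.inv.pow_const 5).const_mul 2).mul (hc.inner (aemeasurable_rot ha))).mul
    ((hd.inner (aemeasurable_rot ha)).add (hc.inner (aemeasurable_rot hb)))).sub
    ((((ha.norm.inv.pow_const 7).const_mul 5).mul ((hc.inner (aemeasurable_rot ha)).pow_const 2)).mul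
      (ha.inner hb))

/-- A lower bound for `‖v + t u‖`, uniform for small `t`. -/
theorem exists_uniform_bounds {v u u' : ℝ → Plane} (hv : ContinuousOn v (Icc 0 1))
    (hu : ContinuousOn u (Icc 0 1)) (hu' : ContinuousOn u' (Icc 0 1))
    (h0 : ∀ x ∈ Icc (0 : ℝ) 1, v x ≠ 0) :
    ∃ ε > 0, ε ≤ 1 ∧ ∃ R C : ℝ, 0 ≤ C ∧ ∀ x ∈ Icc (0 : ℝ) 1, ‖u x‖ ≤ C ∧ ‖u' x‖ ≤ C ∧
      ∀ t ∈ Metric.ball (0 : ℝ) ε, v x + t • u x ≠ 0 ∧ ‖v x + t • u x‖⁻¹ ≤ R ∧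
        ‖v x + t • u x‖ ≤ C := by
  obtain ⟨z, hz, hmin⟩ := isCompact_Icc.exists_isMinOn (nonempty_Icc.mpr zero_le_one) hv.norm
  obtain ⟨Cv, hCv⟩ := isCompact_Icc.exists_bound_of_continuousOn hv
  obtain ⟨Cu, hCu⟩ := isCompact_Icc.exists_bound_of_continuousOn hu
  obtain ⟨Cu', hCu'⟩ := isCompact_Icc.exists_bound_of_continuousOn hu'
  have hm : 0 < ‖v z‖ := norm_pos_iff.mpr (h0 z hz)
  have p1 : 0 ≤ Cv := (norm_nonneg _).trans (hCv z hz)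
  have p2 : 0 ≤ Cu := (norm_nonneg _).trans (hCu z hz)
  have p3 : 0 ≤ Cu' := (norm_nonneg _).trans (hCu' z hz)
  set m := ‖v z‖
  -- The radius keeps `‖t u‖ ≤ m / 2`, half the minimal speed. The bound `ε ≤ 1` later absorbs `t
  -- u'`, and the sum of the three suprema serves as one constant for every upper bound.
  refine ⟨min 1 (m / (2 * (Cu + 1))), by positivity, min_le_left _ _, 2 / m, Cv + Cu + Cu',
    by positivity, fun x hx ↦ ⟨by linarith [hCu x hx], by linarith [hCu' x hx], fun t ht ↦ ?_⟩⟩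
  rw [mem_ball_zero_iff, Real.norm_eq_abs, lt_min_iff, lt_div_iff₀ (by positivity)] at ht
  have q1 : ‖t • u x‖ ≤ |t| * Cu := by rw [norm_smul, Real.norm_eq_abs]; gcongr; exact hCu x hx
  have q2 : ‖t • u x‖ ≤ m / 2 := by nlinarith [abs_nonneg t]
  have q3 : m ≤ ‖v x‖ := hmin hx
  have q4 : m / 2 ≤ ‖v x + t • u x‖ := by
    have := norm_sub_le (v x + t • u x) (t • u x)
    rw [add_sub_cancel_right] at this
    linarith
  have q5 : 0 < ‖v x + t • u x‖ := by linarith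
  refine ⟨norm_pos_iff.mp q5, ?_, ?_⟩
  · rw [← inv_div]; exact inv_anti₀ (by positivity) q4
  · have := norm_add_le (v x) (t • u x)
    nlinarith [hCv x hx]

theorem hasDerivAt_integral_bend {v w u u' : ℝ → Plane} (hv : ContinuousOn v (Icc 0 1))
    (hw : MemLp w 2 (volume.restrict (Ioo (0 : ℝ) 1)))
    (hu : ContinuousOn u (Icc 0 1)) (hu' : ContinuousOn u' (Icc 0 1))
    (h0 : ∀ x ∈ Icc (0 : ℝ) 1, v x ≠ 0) :
    HasDerivAt (fun t : ℝ ↦ ∫ x in (0 : ℝ)..1, bend (v x + t • u x) (w x + t • u' x))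
      (∫ x in (0 : ℝ)..1, bendDeriv (v x) (w x) (u x) (u' x)) 0 := by
  obtain ⟨ε, hε, hε1, R, C, hC, hb⟩ := exists_uniform_bounds hv hu hu' h0
  simp_rw [← integral_Ioo_eq]
  have mv := aemeasurable_of_continuousOn hv
  have mu := aemeasurable_of_continuousOn hu
  have mu' := aemeasurable_of_continuousOn hu'
  have mw := hw.aestronglyMeasurable.aemeasurable
  have mc : ∀ t : ℝ, AEMeasurable (fun x ↦ w x + t • u' x) (volume.restrict (Ioo (0 : ℝ) 1)) :=
    fun t ↦ mw.add (mu'.const_smul t)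
  have hw1 : MemLp (fun x ↦ ‖w x‖ + C) 2 (volume.restrict (Ioo (0 : ℝ) 1)) :=
    hw.norm.add (memLp_const C)
  have hsq : Integrable (fun x ↦ (‖w x‖ + C) ^ 2) (volume.restrict (Ioo (0 : ℝ) 1)) :=
    hw1.integrable_sq
  have ma : ∀ t : ℝ, AEMeasurable (fun x ↦ v x + t • u x) (volume.restrict (Ioo (0 : ℝ) 1)) :=
    fun t ↦ mv.add (mu.const_smul t)
  have hm : ∀ t : ℝ, AEMeasurable (fun x ↦ bend (v x + t • u x) (w x + t • u' x))
      (volume.restrict (Ioo (0 : ℝ) 1)) := fun t ↦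
    aemeasurable_bend (ma t) (mc t)
  have key := hasDerivAt_integral_of_dominated_loc_of_deriv_le
    (μ := volume.restrict (Ioo (0 : ℝ) 1)) (Metric.ball_mem_nhds (0 : ℝ) hε)
    (F := fun t x ↦ bend (v x + t • u x) (w x + t • u' x))
    (F' := fun t x ↦ bendDeriv (v x + t • u x) (w x + t • u' x) (u x) (u' x))
    -- For `|t| < 1` both `‖w + t u'‖` and `‖u'‖` are at most `‖w‖ + C`, which plays the role of `D`
    -- in `abs_bendDeriv_le`.
    (bound := fun x ↦ (4 * R ^ 5 * C ^ 2 + 5 * R ^ 7 * C ^ 4) * (‖w x‖ + C) ^ 2)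
    (Filter.Eventually.of_forall fun t ↦ (hm t).aestronglyMeasurable) ?_ ?_ ?_
    (hsq.const_mul _) ?_
  · simpa using key.2
  · refine Integrable.mono' (g := fun x ↦ R ^ 5 * C ^ 2 * (‖w x‖ + C) ^ 2) (hsq.const_mul _)
      (hm 0).aestronglyMeasurable ?_
    filter_upwards [ae_restrict_mem measurableSet_Ioo] with x hx
    obtain ⟨-, -, h3⟩ := hb x (Ioo_subset_Icc_self hx)
    obtain ⟨-, h4, h5⟩ := h3 0 (Metric.mem_ball_self hε)
    rw [zero_smul, add_zero] at h4 h5 ⊢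
    rw [zero_smul, add_zero, bend, Real.norm_eq_abs, abs_mul, abs_pow, abs_pow,
      abs_of_nonneg (inv_nonneg.mpr (norm_nonneg (v x)))]
    have e1 : |inner ℝ (w x) (rot (v x))| ≤ (‖w x‖ + C) * C :=
      (abs_real_inner_le_norm _ _).trans (by rw [norm_rot]; gcongr; linarith)
    have hR : 0 ≤ R := le_trans (by positivity) h4
    calc _ ≤ R ^ 5 * ((‖w x‖ + C) * C) ^ 2 := by gcongr
      _ = _ := by ring
  · exact (aemeasurable_bendDeriv (ma 0) (mc 0) mu mu').aestronglyMeasurable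
  · filter_upwards [ae_restrict_mem measurableSet_Ioo] with x hx t ht
    obtain ⟨h1, h2, h3⟩ := hb x (Ioo_subset_Icc_self hx)
    obtain ⟨-, h4, h5⟩ := h3 t ht
    refine abs_bendDeriv_le h4 h5 h1 ((norm_add_le _ _).trans ?_)
      (h2.trans (by linarith [norm_nonneg (w x)]))
    gcongr
    rw [norm_smul]
    rw [mem_ball_zero_iff] at ht
    nlinarith [norm_nonneg (u' x)]
  · filter_upwards [ae_restrict_mem measurableSet_Ioo] with x hx t ht
    exact hasDerivAt_bend_line ((hb x (Ioo_subset_Icc_self hx)).2.2 t ht).1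

theorem hasDerivAt_integral_norm {v u : ℝ → Plane} (hv : ContinuousOn v (Icc 0 1))
    (hu : ContinuousOn u (Icc 0 1)) (h0 : ∀ x ∈ Icc (0 : ℝ) 1, v x ≠ 0) :
    HasDerivAt (fun t : ℝ ↦ ∫ x in (0 : ℝ)..1, ‖v x + t • u x‖)
      (∫ x in (0 : ℝ)..1, ‖v x‖⁻¹ * inner ℝ (v x) (u x)) 0 := by
  obtain ⟨ε, hε, hε1, R, C, hC, hb⟩ := exists_uniform_bounds hv hu hu h0
  simp_rw [← integral_Ioo_eq]
  have mv := aemeasurable_of_continuousOn hv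
  have mu := aemeasurable_of_continuousOn hu
  have ma : ∀ t : ℝ, AEMeasurable (fun x ↦ v x + t • u x) (volume.restrict (Ioo (0 : ℝ) 1)) :=
    fun t ↦ mv.add (mu.const_smul t)
  have hm : ∀ t : ℝ, AEMeasurable (fun x ↦ ‖v x + t • u x‖)
      (volume.restrict (Ioo (0 : ℝ) 1)) := fun t ↦ (ma t).norm
  have key := hasDerivAt_integral_of_dominated_loc_of_deriv_le
    (μ := volume.restrict (Ioo (0 : ℝ) 1)) (Metric.ball_mem_nhds (0 : ℝ) hε)
    (F := fun t x ↦ ‖v x + t • u x‖)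
    (F' := fun t x ↦ ‖v x + t • u x‖⁻¹ * inner ℝ (v x + t • u x) (u x))
    (bound := fun _ ↦ C)
    (Filter.Eventually.of_forall fun t ↦ (hm t).aestronglyMeasurable) ?_ ?_ ?_
    (integrable_const C) ?_
  · simpa using key.2
  · refine Integrable.mono' (integrable_const C) (hm 0).aestronglyMeasurable ?_
    filter_upwards [ae_restrict_mem measurableSet_Ioo] with x hx
    simpa using ((hb x (Ioo_subset_Icc_self hx)).2.2 0 (Metric.mem_ball_self hε)).2.2
  · exact ((ma 0).norm.inv.mul ((ma 0).inner mu)).aestronglyMeasurable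
  · filter_upwards [ae_restrict_mem measurableSet_Ioo] with x hx t ht
    obtain ⟨h1, h2, h3⟩ := hb x (Ioo_subset_Icc_self hx)
    obtain ⟨h4, -, h5⟩ := h3 t ht
    rw [Real.norm_eq_abs, abs_mul, abs_of_nonneg (inv_nonneg.mpr (norm_nonneg _)),
      inv_mul_le_iff₀ (norm_pos_iff.mpr h4)]
    exact (abs_real_inner_le_norm _ _).trans (by gcongr)
  · filter_upwards [ae_restrict_mem measurableSet_Ioo] with x hx t ht
    exact hasDerivAt_norm_line ((hb x (Ioo_subset_Icc_self hx)).2.2 t ht).1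

/-- The first variation of the energy. -/
theorem hasDerivAt_energy {γ v w ψ u u' : ℝ → Plane}
    (hγ : ∀ x ∈ Icc (0 : ℝ) 1, HasDerivWithinAt γ (v x) (Icc 0 1) x) (hvw : IsAC v w)
    (hw : MemLp w 2 (volume.restrict (Ioo (0 : ℝ) 1))) (h0 : ∀ x ∈ Icc (0 : ℝ) 1, v x ≠ 0)
    (hψ : ∀ x, HasDerivAt ψ (u x) x) (hu : ∀ x, HasDerivAt u (u' x) x) (hu' : Continuous u') :
    HasDerivAt (fun t : ℝ ↦ energy (fun x ↦ γ x + t • ψ x))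
      ((∫ x in (0 : ℝ)..1, bendDeriv (v x) (w x) (u x) (u' x)) +
        ∫ x in (0 : ℝ)..1, ‖v x‖⁻¹ * inner ℝ (v x) (u x)) 0 := by
  have hcu : Continuous u := continuous_iff_continuousAt.mpr fun x ↦ (hu x).continuousAt
  refine ((hasDerivAt_integral_bend hvw.continuousOn hw hcu.continuousOn hu'.continuousOn h0).add
    (hasDerivAt_integral_norm hvw.continuousOn hcu.continuousOn h0)).congr_of_eventuallyEq ?_
  -- The formula for the energy density needs `γ + tψ` to be regular, so it is established only for
  -- small `t`, which suffices for the derivative at `0`.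
  obtain ⟨ε, hε, hε1, R, C, hC, hb⟩ := exists_uniform_bounds hvw.continuousOn hcu.continuousOn
    hu'.continuousOn h0
  filter_upwards [Metric.ball_mem_nhds (0 : ℝ) hε] with t ht
  have hdx : ∀ x ∈ Icc (0 : ℝ) 1, dx (fun x ↦ γ x + t • ψ x) x = v x + t • u x := fun x hx ↦
    ((hγ x hx).add ((hψ x).hasDerivWithinAt.const_smul t)).derivWithin
      (uniqueDiffWithinAt_unitInterval hx)
  rw [energy, elasticEnergy, length, Pi.add_apply]
  congr 1
  · rw [← integral_Ioo_eq, ← integral_Ioo_eq]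
    refine setIntegral_congr_ae measurableSet_Ioo ?_
    filter_upwards [hvw.deriv] with x hx hx'
    have hne := ((hb x (Ioo_subset_Icc_self hx')).2.2 t ht).1
    rw [curvature_eq hdx hx' ((hx hx').add ((hu x).const_smul t)) hne,
      hdx x (Ioo_subset_Icc_self hx'), bend]
    have := norm_ne_zero_iff.mpr hne
    field_simp
  · refine intervalIntegral.integral_congr fun x hx ↦ ?_
    rw [uIcc_of_le zero_le_one] at hx
    simp only [hdx x hx]

end FirstVariation

/-! ### The weak Euler–Lagrange equation and its first-order form. -/

section EulerLagrange

/-- Since `U` need not vanish at the ends, no additive constant remains in `A`; the constraint `∫ U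
= 0` costs only the mean of `B`. The resulting primitive is zero at both `0` and `1`, the source of
the boundary conditions on the curvature. -/
theorem ae_eq_primitive_of_weak {A B : ℝ → Plane} (hA : IntervalIntegrable A volume 0 1)
    (hB : IntervalIntegrable B volume 0 1)
    (h : ∀ U : ℝ → ℝ, ContDiff ℝ ∞ U → ∫ x in (0 : ℝ)..1, U x = 0 →
      ∫ x in (0 : ℝ)..1, (deriv U x • A x + U x • B x) = 0) :
    ∀ᵐ x, x ∈ Ioo (0 : ℝ) 1 →
      A x = ∫ t in (0 : ℝ)..x, (B t - ∫ s in (0 : ℝ)..1, B s) := by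
  set c := ∫ s in (0 : ℝ)..1, B s with hc
  have hBc : IntervalIntegrable (fun t ↦ B t - c) volume 0 1 := hB.sub intervalIntegrable_const
  have hP : IsAC (fun x ↦ ∫ t in (0 : ℝ)..x, (B t - c)) (fun t ↦ B t - c) := by
    simpa using IsAC.primitive hBc 0
  have hP1 : ∫ t in (0 : ℝ)..1, (B t - c) = 0 := by
    rw [intervalIntegral.integral_sub hB intervalIntegrable_const, ← hc]
    simp
  set P : ℝ → Plane := fun x ↦ ∫ t in (0 : ℝ)..x, (B t - c)
  have hPi : IntervalIntegrable P volume 0 1 :=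
    ContinuousOn.intervalIntegrable (by rw [uIcc_of_le zero_le_one]; exact hP.continuousOn)
  have hz := isOpen_Ioo.ae_eq_zero_of_integral_contDiff_smul_eq_zero (U := Ioo (0 : ℝ) 1)
    (μ := volume) (f := fun x ↦ A x - P x)
    (IntegrableOn.locallyIntegrableOn (intervalIntegrable_iff_Ioo.mp (hA.sub hPi))) ?_
  · filter_upwards [hz] with x hx hx'
    exact sub_eq_zero.mp (hx hx')
  intro φ hφ _ hs
  rw [integral_eq_setIntegral_of_tsupport hs]
  -- An arbitrary test function `φ` is `U'` for the admissible `U = Φ - m`. Its mass is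
  -- unrestricted, because `U 0` and `U 1` may differ.
  set Φ : ℝ → ℝ := fun x ↦ ∫ t in (0 : ℝ)..x, φ t
  have hΦ : ContDiff ℝ ∞ Φ := contDiff_primitive hφ
  have hΦd : ∀ x, HasDerivAt Φ (φ x) x := deriv_primitive hφ.continuous
  set m := ∫ x in (0 : ℝ)..1, Φ x with hm
  have iΦ : IntervalIntegrable Φ volume 0 1 := hΦ.continuous.intervalIntegrable _ _
  have h1 := h (fun x ↦ Φ x - m) (hΦ.sub contDiff_const) (by
    rw [intervalIntegral.integral_sub iΦ intervalIntegrable_const, ← hm]; simp)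
  have hd : ∀ x, deriv (fun x ↦ Φ x - m) x = φ x := fun x ↦ ((hΦd x).sub_const m).deriv
  have cφ : ContinuousOn φ (uIcc (0 : ℝ) 1) := hφ.continuous.continuousOn
  have cΦ : ContinuousOn Φ (uIcc (0 : ℝ) 1) := hΦ.continuous.continuousOn
  have hmB : IntervalIntegrable (fun x ↦ m • B x) volume 0 1 := hB.smul m
  simp_rw [hd, sub_smul] at h1
  rw [intervalIntegral.integral_add (hA.continuousOn_smul cφ)
    ((hB.continuousOn_smul cΦ).sub hmB),
    intervalIntegral.integral_sub (hB.continuousOn_smul cΦ) hmB,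
    intervalIntegral.integral_smul, ← hc] at h1
  have h2 := integral_deriv_smul_add (hΦ.of_le (by simp)) hP hBc
  have hP0 : P 0 = 0 := by simp [P]
  have hP1' : P 1 = 0 := hP1
  simp_rw [fun x ↦ (hΦd x).deriv, smul_sub] at h2
  rw [hP0, hP1', intervalIntegral.integral_sub (hB.continuousOn_smul cΦ)
    (intervalIntegrable_const.continuousOn_smul cΦ), intervalIntegral.integral_smul_const,
    ← hm] at h2
  simp_rw [smul_sub]
  rw [intervalIntegral.integral_sub (hA.continuousOn_smul cφ) (hPi.continuousOn_smul cφ), h2,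
    smul_zero, smul_zero, sub_zero, zero_sub, sub_neg_eq_add, h1]

/-- The coefficient of `∂ₓ² ψ` in the first variation at a curve with derivatives `a` and `c`. -/
noncomputable def bendMoment (a c : Plane) : Plane :=
  (2 * ‖a‖⁻¹ ^ 5 * inner ℝ c (rot a)) • rot a

/-- The coefficient of `∂ₓ ψ` in the first variation of the elastic energy at a curve with
derivatives `a` and `c`. -/
noncomputable def bendForce (a c : Plane) : Plane :=
  -((5 * ‖a‖⁻¹ ^ 7 * inner ℝ c (rot a) ^ 2) • a) - (2 * ‖a‖⁻¹ ^ 5 * inner ℝ c (rot a)) • rot c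

theorem bendDeriv_eq (a c b d : Plane) :
    bendDeriv a c b d = inner ℝ d (bendMoment a c) + inner ℝ b (bendForce a c) := by
  have : inner ℝ c (rot b) = -inner ℝ b (rot c) := by
    rw [← inner_rot_left, real_inner_comm]
  rw [bendDeriv, bendMoment, bendForce, inner_sub_right, inner_neg_right, inner_smul_right,
    inner_smul_right, inner_smul_right, this, real_inner_comm a b]
  ring

theorem aestronglyMeasurable_bendMoment {a c : ℝ → Plane} {μ : Measure ℝ} (ha : AEMeasurable a μ)
    (hc : AEMeasurable c μ) : AEStronglyMeasurable (fun x ↦ bendMoment (a x) (c x)) μ :=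
  ((((ha.norm.inv.pow_const 5).const_mul 2).mul (hc.inner (aemeasurable_rot ha))).smul
    (aemeasurable_rot ha)).aestronglyMeasurable

theorem aestronglyMeasurable_bendForce {a c : ℝ → Plane} {μ : Measure ℝ} (ha : AEMeasurable a μ)
    (hc : AEMeasurable c μ) : AEStronglyMeasurable (fun x ↦ bendForce (a x) (c x)) μ :=
  (((((ha.norm.inv.pow_const 7).const_mul 5).mul
    ((hc.inner (aemeasurable_rot ha)).pow_const 2)).smul ha).neg.sub
    ((((ha.norm.inv.pow_const 5).const_mul 2).mul (hc.inner (aemeasurable_rot ha))).smul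
    (aemeasurable_rot hc))).aestronglyMeasurable

theorem intervalIntegrable_bend {v w : ℝ → Plane} (hv : ContinuousOn v (Icc 0 1))
    (hw : MemLp w 2 (volume.restrict (Ioo (0 : ℝ) 1))) (h0 : ∀ x ∈ Icc (0 : ℝ) 1, v x ≠ 0) :
    IntervalIntegrable (fun x ↦ bendMoment (v x) (w x)) volume 0 1 ∧
      IntervalIntegrable (fun x ↦ bendForce (v x) (w x)) volume 0 1 := by
  rw [intervalIntegrable_iff_Ioo, intervalIntegrable_iff_Ioo]
  obtain ⟨ε, hε, -, R, C, hC, hb⟩ := exists_uniform_bounds hv continuousOn_const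
    continuousOn_const (u := fun _ ↦ 0) (u' := fun _ ↦ 0) h0
  have hb' : ∀ x ∈ Icc (0 : ℝ) 1, ‖v x‖⁻¹ ≤ R ∧ ‖v x‖ ≤ C := fun x hx ↦ by
    simpa using ((hb x hx).2.2 0 (Metric.mem_ball_self hε)).2
  have mv := aemeasurable_of_continuousOn hv
  have mw := hw.aestronglyMeasurable.aemeasurable
  have hw1 : Integrable (fun x ↦ ‖w x‖) (volume.restrict (Ioo (0 : ℝ) 1)) :=
    (hw.integrable (by norm_num)).norm
  have hw2 : Integrable (fun x ↦ ‖w x‖ ^ 2) (volume.restrict (Ioo (0 : ℝ) 1)) :=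
    hw.norm.integrable_sq
  have hq : ∀ x ∈ Icc (0 : ℝ) 1, |inner ℝ (w x) (rot (v x))| ≤ ‖w x‖ * C := fun x hx ↦
    (abs_real_inner_le_norm _ _).trans (by rw [norm_rot]; gcongr; exact (hb' x hx).2)
  constructor
  · refine Integrable.mono' (hw1.const_mul (2 * R ^ 5 * C * C))
      (aestronglyMeasurable_bendMoment mv mw) ?_
    filter_upwards [ae_restrict_mem measurableSet_Ioo] with x hx
    obtain ⟨h1, h2⟩ := hb' x (Ioo_subset_Icc_self hx)
    have h3 := hq x (Ioo_subset_Icc_self hx)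
    have hR : 0 ≤ R := le_trans (by positivity) h1
    rw [bendMoment, norm_smul, norm_rot, Real.norm_eq_abs, abs_mul, abs_mul, abs_pow,
      abs_of_nonneg (inv_nonneg.mpr (norm_nonneg (v x))), abs_two]
    calc _ ≤ 2 * R ^ 5 * (‖w x‖ * C) * C := by gcongr
      _ = _ := by ring
  · refine Integrable.mono' (hw2.const_mul (5 * R ^ 7 * C ^ 2 * C + 2 * R ^ 5 * C))
      (aestronglyMeasurable_bendForce mv mw) ?_
    filter_upwards [ae_restrict_mem measurableSet_Ioo] with x hx
    obtain ⟨h1, h2⟩ := hb' x (Ioo_subset_Icc_self hx)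
    have h3 := hq x (Ioo_subset_Icc_self hx)
    have hR : 0 ≤ R := le_trans (by positivity) h1
    rw [bendForce]
    refine (norm_sub_le _ _).trans ?_
    rw [norm_neg, norm_smul, norm_smul, norm_rot, Real.norm_eq_abs, Real.norm_eq_abs]
    simp only [abs_mul, abs_pow, Nat.abs_ofNat, abs_inv, abs_norm]
    calc _ ≤ 5 * R ^ 7 * (‖w x‖ * C) ^ 2 * C + 2 * R ^ 5 * (‖w x‖ * C) * ‖w x‖ := by gcongr
      _ = _ := by ring

/-- The weak Euler-Lagrange equation of a stationary curve. -/
theorem IsStationary.ae_eq_primitive {γ v w : ℝ → Plane} (hstat : IsStationary γ)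
    (hγ : ∀ x ∈ Icc (0 : ℝ) 1, HasDerivWithinAt γ (v x) (Icc 0 1) x) (hvw : IsAC v w)
    (hw : MemLp w 2 (volume.restrict (Ioo (0 : ℝ) 1))) (h0 : ∀ x ∈ Icc (0 : ℝ) 1, v x ≠ 0) :
    ∃ B : ℝ → Plane, B = (fun x ↦ bendForce (v x) (w x) + ‖v x‖⁻¹ • v x) ∧
      IntervalIntegrable B volume 0 1 ∧
      ∀ᵐ x, x ∈ Ioo (0 : ℝ) 1 → bendMoment (v x) (w x) =
        ∫ t in (0 : ℝ)..x, (B t - ∫ s in (0 : ℝ)..1, B s) := by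
  obtain ⟨iA, iF⟩ := intervalIntegrable_bend hvw.continuousOn hw h0
  have iT : IntervalIntegrable (fun x ↦ ‖v x‖⁻¹ • v x) volume 0 1 := by
    apply ContinuousOn.intervalIntegrable
    rw [uIcc_of_le zero_le_one]
    exact (hvw.continuousOn.norm.inv₀ fun x hx ↦ norm_ne_zero_iff.mpr (h0 x hx)).smul
      hvw.continuousOn
  refine ⟨_, rfl, iF.add iT, ae_eq_primitive_of_weak iA (iF.add iT) fun U hU hU0 ↦ ?_⟩
  refine ext_inner_left ℝ fun e ↦ ?_
  have hUd : ∀ x, HasDerivAt U (deriv U x) x := fun x ↦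
    (hU.differentiable (by simp) x).hasDerivAt
  have cU : ContinuousOn U (uIcc (0 : ℝ) 1) := hU.continuous.continuousOn
  have cU' : ContinuousOn (deriv U) (uIcc (0 : ℝ) 1) :=
    (hU.continuous_deriv (by simp)).continuousOn
  -- The zero mean of `U` is exactly what makes this variation admissible: it vanishes at both ends.
  have hψs : ContDiff ℝ ∞ (fun x ↦ (∫ t in (0 : ℝ)..x, U t) • e) :=
    (contDiff_primitive hU).smul contDiff_const
  have hE := hasDerivAt_energy (ψ := fun x ↦ (∫ t in (0 : ℝ)..x, U t) • e) (u := fun x ↦ U x • e)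
    (u' := fun x ↦ deriv U x • e) hγ hvw hw h0
    (fun x ↦ (deriv_primitive hU.continuous x).smul_const e) (fun x ↦ (hUd x).smul_const e)
    ((hU.continuous_deriv (by simp)).smul continuous_const)
  have hz := hE.unique (hstat _ hψs.contDiffOn (by simp [hU0]))
  have e1 : ∫ x in (0 : ℝ)..1, bendDeriv (v x) (w x) (U x • e) (deriv U x • e) =
      inner ℝ e (∫ x in (0 : ℝ)..1,
        (deriv U x • bendMoment (v x) (w x) + U x • bendForce (v x) (w x))) := by
    rw [← innerSL_apply_apply ℝ e, ← (innerSL ℝ e).intervalIntegral_comp_comm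
      ((iA.continuousOn_smul cU').add (iF.continuousOn_smul cU))]
    refine intervalIntegral.integral_congr fun x _ ↦ ?_
    simp [bendDeriv_eq, inner_smul_left, inner_add_right, inner_smul_right]
  have e2 : ∫ x in (0 : ℝ)..1, ‖v x‖⁻¹ * inner ℝ (v x) (U x • e) =
      inner ℝ e (∫ x in (0 : ℝ)..1, U x • ‖v x‖⁻¹ • v x) := by
    rw [← innerSL_apply_apply ℝ e, ← (innerSL ℝ e).intervalIntegral_comp_comm
      (iT.continuousOn_smul cU)]
    refine intervalIntegral.integral_congr fun x _ ↦ ?_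
    simp [inner_smul_right, real_inner_comm e]
    ring
  rw [e1, e2, ← inner_add_right, ← intervalIntegral.integral_add
    ((iA.continuousOn_smul cU').add (iF.continuousOn_smul cU)) (iT.continuousOn_smul cU)] at hz
  rw [inner_zero_right]
  refine Eq.trans ?_ hz
  congr 1
  refine intervalIntegral.integral_congr fun x _ ↦ ?_
  simp only [smul_add, add_assoc]

theorem normSq_smul_eq (a w : Plane) :
    ‖a‖ ^ 2 • w = (inner ℝ a w : ℝ) • a + (inner ℝ w (rot a) : ℝ) • rot a := by
  rw [← real_inner_self_eq_norm_sq]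
  simp only [inner_plane]
  ext i
  fin_cases i <;> simp <;> ring

theorem normSq_smul_rot_eq (a w : Plane) :
    ‖a‖ ^ 2 • rot w = (inner ℝ a w : ℝ) • rot a - (inner ℝ w (rot a) : ℝ) • a := by
  rw [← real_inner_self_eq_norm_sq]
  simp only [inner_plane]
  ext i
  fin_cases i <;> simp <;> ring

/-- The left side is the product rule for `‖v‖⁻¹ • v`; its tangential part cancels, leaving speed
times curvature times normal. -/
theorem tangent_deriv_eq {a : Plane} (ha : a ≠ 0) (w : Plane) :
    ‖a‖⁻¹ • w + (-(‖a‖⁻¹ * inner ℝ a w) / ‖a‖ ^ 2) • a =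
      ‖a‖ • (‖a‖⁻¹ ^ 3 * inner ℝ w (rot a)) • rot (‖a‖⁻¹ • a) := by
  have hn : ‖a‖ ≠ 0 := norm_ne_zero_iff.mpr ha
  have h1 : w = (‖a‖ ^ 2)⁻¹ • ((inner ℝ a w : ℝ) • a + (inner ℝ w (rot a) : ℝ) • rot a) := by
    rw [← normSq_smul_eq, inv_smul_smul₀ (by positivity)]
  rw [rot_smul]
  nth_rw 1 [h1]
  match_scalars <;> field_simp
  ring

/-- The left side is the product rule for `‖v‖ • P`. The weight `‖v‖` cancels the
parametrization-dependent terms in `⟨a, w⟩`. The coefficient `-3` is `-5` from the density plus `2`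
from the tangential part of `rot w`. -/
theorem moment_deriv_eq {a : Plane} (ha : a ≠ 0) (w c : Plane) :
    ‖a‖ • (bendForce a w + ‖a‖⁻¹ • a - c) + (‖a‖⁻¹ * inner ℝ a w) • bendMoment a w =
      ‖a‖ • ((1 - 3 * (‖a‖⁻¹ ^ 3 * inner ℝ w (rot a)) ^ 2) • (‖a‖⁻¹ • a) - c) := by
  have hn : ‖a‖ ≠ 0 := norm_ne_zero_iff.mpr ha
  have h1 : rot w = (‖a‖ ^ 2)⁻¹ • ((inner ℝ a w : ℝ) • rot a - (inner ℝ w (rot a) : ℝ) • a) := by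
    rw [← normSq_smul_rot_eq, inv_smul_smul₀ (by positivity)]
  rw [bendForce, bendMoment, h1]
  match_scalars <;> field_simp <;> ring

/-- The first-order system satisfied by the unit tangent and the bending moment `2 K ν` of an
elastica `β` with curvature `K` that is clamped at neither end. -/
structure IsElastica (β : ℝ → Plane) (K : ℝ → ℝ) (c : Plane) : Prop where
  differentiable : DifferentiableOn ℝ β (Icc 0 1)
  continuousOn_dx : ContinuousOn (dx β) (Icc 0 1)
  regular : IsRegular β
  tangent_deriv : ∀ x ∈ Icc (0 : ℝ) 1,
    HasDerivWithinAt (tangent β) (‖dx β x‖ • K x • normal β x) (Icc 0 1) x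
  moment_deriv : ∀ x ∈ Icc (0 : ℝ) 1, HasDerivWithinAt (fun x ↦ (2 * K x) • normal β x)
    (‖dx β x‖ • ((1 - 3 * K x ^ 2) • tangent β x - c)) (Icc 0 1) x
  zero : K 0 = 0
  one : K 1 = 0

theorem IsDrop.exists_isElastica {γ : ℝ → Plane} (hdrop : IsDrop γ) (hstat : IsStationary γ) :
    ∃ K c, IsElastica γ K c := by
  obtain ⟨v, w, hw, hvw, hγ⟩ := hdrop.isH2.exists_isAC
  have hdx : ∀ x ∈ Icc (0 : ℝ) 1, dx γ x = v x := fun x hx ↦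
    (hγ x hx).derivWithin (uniqueDiffWithinAt_unitInterval hx)
  have h0 : ∀ x ∈ Icc (0 : ℝ) 1, v x ≠ 0 := fun x hx ↦ hdx x hx ▸ hdrop.regular x hx
  have hpos : ∀ x ∈ Icc (0 : ℝ) 1, 0 < ‖v x‖ := fun x hx ↦ norm_pos_iff.mpr (h0 x hx)
  obtain ⟨B, hB, iB, hP⟩ := hstat.ae_eq_primitive hγ hvw hw h0
  set c := ∫ s in (0 : ℝ)..1, B s with hc
  have iBc : IntervalIntegrable (fun t ↦ B t - c) volume 0 1 := iB.sub intervalIntegrable_const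
  have hPac : IsAC (fun x ↦ ∫ t in (0 : ℝ)..x, (B t - c)) (fun t ↦ B t - c) := by
    simpa using IsAC.primitive iBc 0
  have hP0 : ∫ t in (0 : ℝ)..0, (B t - c) = 0 := by simp
  have hP1 : ∫ t in (0 : ℝ)..1, (B t - c) = 0 := by
    rw [intervalIntegral.integral_sub iB intervalIntegrable_const, ← hc]
    simp
  set P : ℝ → Plane := fun x ↦ ∫ t in (0 : ℝ)..x, (B t - c)
  have hn := hvw.norm_of_ne_zero h0
  have hτ := (hn.inv_of_pos hpos).smul hvw
  have hM := hn.smul hPac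
  have hτc := hτ.continuousOn
  set τ : ℝ → Plane := fun x ↦ ‖v x‖⁻¹ • v x with hτdef
  set M : ℝ → Plane := fun x ↦ ‖v x‖ • P x with hMdef
  have hνc : ContinuousOn (fun x ↦ rot (τ x)) (Icc 0 1) := rotL.continuous.comp_continuousOn hτc
  -- The pointwise curvature is so far known only almost everywhere. `K` is read off from the
  -- continuous field `M`, so that the a.e. derivatives of `τ` and `M` become continuous and can be
  -- taken everywhere.
  set K : ℝ → ℝ := fun x ↦ inner ℝ (M x) (rot (τ x)) / 2 with hK
  have hKc : ContinuousOn K (Icc 0 1) := (hM.continuousOn.inner hνc).div_const 2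
  have hτ1 : ∀ x ∈ Icc (0 : ℝ) 1, ‖rot (τ x)‖ = 1 := fun x hx ↦ by
    rw [norm_rot, hτdef, norm_smul, norm_inv, norm_norm, inv_mul_cancel₀ (hpos x hx).ne']
  have hMae : ∀ᵐ x, x ∈ Ioo (0 : ℝ) 1 →
      M x = (2 * (‖v x‖⁻¹ ^ 3 * inner ℝ (w x) (rot (v x)))) • rot (τ x) := by
    filter_upwards [hP] with x hx hx'
    have := (hpos x (Ioo_subset_Icc_self hx')).ne'
    rw [hMdef]
    simp only [P]
    rw [← hx hx', bendMoment, hτdef, rot_smul]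
    match_scalars
    field_simp
  have hKae : ∀ᵐ x, x ∈ Ioo (0 : ℝ) 1 →
      K x = ‖v x‖⁻¹ ^ 3 * inner ℝ (w x) (rot (v x)) := by
    filter_upwards [hMae] with x hx hx'
    rw [hK]
    simp only
    rw [hx hx', inner_smul_left, real_inner_self_eq_norm_sq,
      hτ1 x (Ioo_subset_Icc_self hx')]
    simp
  have hMK : ∀ x ∈ Icc (0 : ℝ) 1, M x = (2 * K x) • rot (τ x) := by
    refine eqOn_of_ae_eq hM.continuousOn ((hKc.const_mul 2).smul hνc) ?_
    filter_upwards [hMae, hKae] with x h1 h2 hx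
    rw [h1 hx, h2 hx]
  have hτ' : IsAC τ (fun x ↦ ‖v x‖ • K x • rot (τ x)) := by
    refine hτ.congr_deriv ?_
    filter_upwards [hKae] with x h1 hx
    rw [h1 hx]
    exact tangent_deriv_eq (h0 x (Ioo_subset_Icc_self hx)) (w x)
  have hM' : IsAC M (fun x ↦ ‖v x‖ • ((1 - 3 * K x ^ 2) • τ x - c)) := by
    refine hM.congr_deriv ?_
    filter_upwards [hKae, hP] with x h1 h2 hx
    have h2' : bendMoment (v x) (w x) = P x := h2 hx
    rw [h1 hx, ← h2', hB]
    exact moment_deriv_eq (h0 x (Ioo_subset_Icc_self hx)) (w x) c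
  have htan : ∀ x ∈ Icc (0 : ℝ) 1, tangent γ x = τ x := fun x hx ↦ tangent_eq hdx hx
  have hnor : ∀ x ∈ Icc (0 : ℝ) 1, normal γ x = rot (τ x) := fun x hx ↦ by
    rw [normal, htan x hx]
  refine ⟨K, c, fun x hx ↦ (hγ x hx).differentiableWithinAt, hvw.continuousOn.congr hdx,
    hdrop.regular, fun x hx ↦ ?_, fun x hx ↦ ?_, ?_, ?_⟩
  · rw [hdx x hx, hnor x hx]
    exact (hτ'.hasDerivWithinAt (hvw.continuousOn.norm.smul (hKc.smul hνc)) hx).congr htan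
      (htan x hx)
  · rw [hdx x hx, htan x hx]
    have hcont : ContinuousOn (fun x ↦ ‖v x‖ • ((1 - 3 * K x ^ 2) • τ x - c)) (Icc 0 1) :=
      hvw.continuousOn.norm.smul
        (((continuousOn_const.sub ((hKc.pow 2).const_mul 3)).smul hτc).sub continuousOn_const)
    have hcg : ∀ y ∈ Icc (0 : ℝ) 1, (2 * K y) • normal γ y = M y := fun y hy ↦ by
      rw [hMK y hy, hnor y hy]
    exact (hM'.hasDerivWithinAt hcont hx).congr hcg (hcg x hx)
  · simp [hK, hMdef, P]
  · have : P 1 = 0 := hP1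
    simp [hK, hMdef, this]

end EulerLagrange

/-! ### Changes of parameter of class `C¹`. -/

section ParameterChange

namespace IsParamChange

variable {φ : ℝ → ℝ}

theorem hasDerivWithinAt (h : IsParamChange φ) {x : ℝ} (hx : x ∈ Icc (0 : ℝ) 1) :
    HasDerivWithinAt φ (derivWithin φ (Icc 0 1) x) (Icc 0 1) x :=
  (h.contDiffOn.differentiableOn one_ne_zero x hx).hasDerivWithinAt

theorem continuousOn_derivWithin (h : IsParamChange φ) :
    ContinuousOn (derivWithin φ (Icc 0 1)) (Icc 0 1) :=
  h.contDiffOn.continuousOn_derivWithin (uniqueDiffOn_Icc zero_lt_one) le_rfl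

theorem strictMonoOn (h : IsParamChange φ) : StrictMonoOn φ (Icc 0 1) := by
  refine strictMonoOn_of_deriv_pos (convex_Icc 0 1) h.contDiffOn.continuousOn fun x hx ↦ ?_
  rw [interior_Icc] at hx
  rw [← derivWithin_of_mem_nhds (Icc_mem_nhds hx.1 hx.2)]
  exact h.deriv_pos x (Ioo_subset_Icc_self hx)

theorem mapsTo (h : IsParamChange φ) : MapsTo φ (Icc 0 1) (Icc 0 1) := fun x hx ↦ by
  have h1 := h.strictMonoOn.monotoneOn (left_mem_Icc.mpr zero_le_one) hx hx.1
  have h2 := h.strictMonoOn.monotoneOn hx (right_mem_Icc.mpr zero_le_one) hx.2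
  rw [h.map_zero] at h1
  rw [h.map_one] at h2
  exact ⟨h1, h2⟩

theorem surjOn (h : IsParamChange φ) : SurjOn φ (Icc 0 1) (Icc 0 1) := by
  have := intermediate_value_Icc zero_le_one h.contDiffOn.continuousOn
  rwa [h.map_zero, h.map_one] at this

theorem exists_inverse (h : IsParamChange φ) :
    ∃ θ, IsParamChange θ ∧ (∀ x ∈ Icc (0 : ℝ) 1, θ (φ x) = x) ∧
      ∀ y ∈ Icc (0 : ℝ) 1, φ (θ y) = y := by
  set θ := Function.invFunOn φ (Icc 0 1)
  have hl : ∀ x ∈ Icc (0 : ℝ) 1, θ (φ x) = x := fun x hx ↦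
    h.strictMonoOn.injOn.leftInvOn_invFunOn hx
  have hr : ∀ y ∈ Icc (0 : ℝ) 1, φ (θ y) = y := fun y hy ↦ h.surjOn.rightInvOn_invFunOn hy
  have hm : MapsTo θ (Icc 0 1) (Icc 0 1) := h.surjOn.mapsTo_invFunOn
  -- Preimages of closed sets under `θ` are images under `φ` of compact sets.
  have hc : ContinuousOn θ (Icc 0 1) := by
    rw [continuousOn_iff_isClosed]
    intro t ht
    refine ⟨φ '' (t ∩ Icc 0 1), ((isCompact_Icc.inter_left ht).image_of_continuousOn
      (h.contDiffOn.continuousOn.mono inter_subset_right)).isClosed, ?_⟩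
    ext y
    constructor
    · rintro ⟨h1, h2⟩
      exact ⟨⟨θ y, ⟨h1, hm h2⟩, hr y h2⟩, h2⟩
    · rintro ⟨⟨x, ⟨h1, h2⟩, rfl⟩, h3⟩
      exact ⟨by rwa [mem_preimage, hl x h2], h3⟩
  have hd : ∀ y ∈ Icc (0 : ℝ) 1,
      HasDerivWithinAt θ (derivWithin φ (Icc 0 1) (θ y))⁻¹ (Icc 0 1) y := fun y hy ↦ by
    have hne := (h.deriv_pos _ (hm hy)).ne'
    have h1 : HasFDerivWithinAt φ (ContinuousLinearEquiv.unitsEquivAut ℝ (Units.mk0 _ hne) :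
        ℝ →L[ℝ] ℝ) (Icc 0 1) (θ y) := (h.hasDerivWithinAt (hm hy)).hasFDerivWithinAt.congr_fderiv
          (by ext; simp)
    have h2 := (h1.of_local_left_inverse (g := θ) (s := Icc 0 1) (a := y)
      ((hc y hy).tendsto_nhdsWithin hm) hy
      (by filter_upwards [self_mem_nhdsWithin] with z hz using hr z hz)).hasDerivWithinAt
    refine h2.congr_deriv ?_
    simp
  have hd' : ∀ y ∈ Icc (0 : ℝ) 1,
      derivWithin θ (Icc 0 1) y = (derivWithin φ (Icc 0 1) (θ y))⁻¹ := fun y hy ↦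
    (hd y hy).derivWithin (uniqueDiffWithinAt_unitInterval hy)
  refine ⟨θ, ⟨?_, fun y hy ↦ ?_, ?_, ?_⟩, hl, hr⟩
  · rw [contDiffOn_one_iff_derivWithin (uniqueDiffOn_Icc zero_lt_one)]
    refine ⟨fun y hy ↦ (hd y hy).differentiableWithinAt, ContinuousOn.congr ?_ hd'⟩
    exact (h.continuousOn_derivWithin.comp hc hm).inv₀ fun y hy ↦ (h.deriv_pos _ (hm hy)).ne'
  · rw [hd' y hy]
    exact inv_pos.mpr (h.deriv_pos _ (hm hy))
  · simpa [h.map_zero] using hl 0 (left_mem_Icc.mpr zero_le_one)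
  · simpa [h.map_one] using hl 1 (right_mem_Icc.mpr zero_le_one)

end IsParamChange

variable {β η : ℝ → Plane} {θ : ℝ → ℝ}

theorem dx_reparam (hβ : DifferentiableOn ℝ β (Icc 0 1)) (hθ : IsParamChange θ)
    (hη : ∀ y ∈ Icc (0 : ℝ) 1, η y = β (θ y)) {y : ℝ} (hy : y ∈ Icc (0 : ℝ) 1) :
    HasDerivWithinAt η (derivWithin θ (Icc 0 1) y • dx β (θ y)) (Icc 0 1) y :=
  ((hβ _ (hθ.mapsTo hy)).hasDerivWithinAt.scomp y (hθ.hasDerivWithinAt hy) hθ.mapsTo).congr hη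
    (hη y hy)

theorem tangent_reparam (hβ : DifferentiableOn ℝ β (Icc 0 1)) (hθ : IsParamChange θ)
    (hη : ∀ y ∈ Icc (0 : ℝ) 1, η y = β (θ y)) {y : ℝ} (hy : y ∈ Icc (0 : ℝ) 1) :
    tangent η y = tangent β (θ y) := by
  have h1 := (dx_reparam hβ hθ hη hy).derivWithin (uniqueDiffWithinAt_unitInterval hy)
  have hp := hθ.deriv_pos y hy
  rw [tangent, tangent, ds, ds, dx, h1, norm_smul, Real.norm_of_nonneg hp.le, smul_smul, ← dx]
  congr 1
  field_simp

/-- Each equation has the speed as a factor, so the chain rule multiplies both sides by `θ'`. No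
second derivative of `θ` occurs, and `C¹` is enough. -/
theorem IsElastica.reparam {K : ℝ → ℝ} {c : Plane} (h : IsElastica β K c) (hθ : IsParamChange θ)
    (hη : ∀ y ∈ Icc (0 : ℝ) 1, η y = β (θ y)) : IsElastica η (fun y ↦ K (θ y)) c := by
  have hdx : ∀ y ∈ Icc (0 : ℝ) 1, dx η y = derivWithin θ (Icc 0 1) y • dx β (θ y) := fun y hy ↦
    (dx_reparam h.differentiable hθ hη hy).derivWithin (uniqueDiffWithinAt_unitInterval hy)
  have htan : ∀ y ∈ Icc (0 : ℝ) 1, tangent η y = tangent β (θ y) := fun y hy ↦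
    tangent_reparam h.differentiable hθ hη hy
  have hnor : ∀ y ∈ Icc (0 : ℝ) 1, normal η y = normal β (θ y) := fun y hy ↦ by
    rw [normal, htan y hy, normal]
  refine ⟨fun y hy ↦ (dx_reparam h.differentiable hθ hη hy).differentiableWithinAt, ?_,
    fun y hy ↦ ?_, fun y hy ↦ ?_, fun y hy ↦ ?_, ?_, ?_⟩
  · exact (hθ.continuousOn_derivWithin.smul
      (h.continuousOn_dx.comp hθ.contDiffOn.continuousOn hθ.mapsTo)).congr hdx
  · rw [hdx y hy]
    exact smul_ne_zero (hθ.deriv_pos y hy).ne' (h.regular _ (hθ.mapsTo hy))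
  · rw [hdx y hy, hnor y hy, norm_smul, Real.norm_of_nonneg (hθ.deriv_pos y hy).le, mul_smul]
    exact ((h.tangent_deriv _ (hθ.mapsTo hy)).scomp y (hθ.hasDerivWithinAt hy) hθ.mapsTo).congr
      htan (htan y hy)
  · rw [hdx y hy, htan y hy, norm_smul, Real.norm_of_nonneg (hθ.deriv_pos y hy).le, mul_smul]
    refine ((h.moment_deriv _ (hθ.mapsTo hy)).scomp y (hθ.hasDerivWithinAt hy) hθ.mapsTo).congr
      (fun z hz ↦ ?_) ?_
    · rw [hnor z hz]; rfl
    · rw [hnor y hy]; rfl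
  · rw [hθ.map_zero, h.zero]
  · rw [hθ.map_one, h.one]

/-- Reparametrization proportional to arclength. -/
theorem exists_constant_speed (hβ : DifferentiableOn ℝ β (Icc 0 1))
    (hβ' : ContinuousOn (dx β) (Icc 0 1)) (h0 : IsRegular β) :
    ∃ φ θ : ℝ → ℝ, IsParamChange φ ∧ IsParamChange θ ∧ (∀ x ∈ Icc (0 : ℝ) 1, θ (φ x) = x) ∧
      ∃ ℓ : ℝ, 0 < ℓ ∧ ∀ y ∈ Icc (0 : ℝ) 1, ‖dx (fun y ↦ β (θ y)) y‖ = ℓ := by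
  have hcn : ContinuousOn (fun x ↦ ‖dx β x‖) (Icc 0 1) := hβ'.norm
  have hi : IntervalIntegrable (fun x ↦ ‖dx β x‖) volume 0 1 :=
    ContinuousOn.intervalIntegrable (by rwa [uIcc_of_le zero_le_one])
  set ℓ := ∫ x in (0 : ℝ)..1, ‖dx β x‖ with hℓ
  have hpos : 0 < ℓ := intervalIntegral.intervalIntegral_pos_of_pos_on hi
    (fun x hx ↦ norm_pos_iff.mpr (h0 x (Ioo_subset_Icc_self hx))) zero_lt_one
  set φ : ℝ → ℝ := fun x ↦ ℓ⁻¹ * ∫ t in (0 : ℝ)..x, ‖dx β t‖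
  have hφd : ∀ x ∈ Icc (0 : ℝ) 1, HasDerivWithinAt φ (ℓ⁻¹ * ‖dx β x‖) (Icc 0 1) x := fun x hx ↦ by
    have := ((IsAC.primitive hi 0).hasDerivWithinAt hcn hx).const_mul ℓ⁻¹
    simpa only [zero_add] using this
  have hφ' : ∀ x ∈ Icc (0 : ℝ) 1, derivWithin φ (Icc 0 1) x = ℓ⁻¹ * ‖dx β x‖ := fun x hx ↦
    (hφd x hx).derivWithin (uniqueDiffWithinAt_unitInterval hx)
  have hφ : IsParamChange φ := by
    refine ⟨?_, fun x hx ↦ ?_, by simp [φ], inv_mul_cancel₀ hpos.ne'⟩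
    · rw [contDiffOn_one_iff_derivWithin (uniqueDiffOn_Icc zero_lt_one)]
      exact ⟨fun x hx ↦ (hφd x hx).differentiableWithinAt, (hcn.const_mul _).congr hφ'⟩
    · rw [hφ' x hx]
      exact mul_pos (inv_pos.mpr hpos) (norm_pos_iff.mpr (h0 x hx))
  obtain ⟨θ, hθ, hl, hr⟩ := hφ.exists_inverse
  refine ⟨φ, θ, hφ, hθ, hl, ℓ, hpos, fun y hy ↦ ?_⟩
  have h1 : dx (fun y ↦ β (θ y)) y = _ := (dx_reparam hβ hθ (fun _ _ ↦ rfl) hy).derivWithin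
    (uniqueDiffWithinAt_unitInterval hy)
  -- Differentiating `φ ∘ θ = id` gives `ℓ⁻¹ ‖dx β (θ y)‖ θ' = 1`, which is the constancy of the
  -- speed.
  have h2 := (((hφd _ (hθ.mapsTo hy)).comp y (hθ.hasDerivWithinAt hy) hθ.mapsTo).congr
    (f₁ := id) (fun z hz ↦ (hr z hz).symm) (hr y hy).symm).derivWithin
    (uniqueDiffWithinAt_unitInterval hy)
  rw [derivWithin_id _ _ (uniqueDiffWithinAt_unitInterval hy)] at h2
  rw [h1, norm_smul, Real.norm_of_nonneg (hθ.deriv_pos y hy).le]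
  field_simp at h2
  linarith

end ParameterChange

/-! ### Consequences of the first-order system. -/

section Elastica

namespace IsElastica

variable {β : ℝ → Plane} {K : ℝ → ℝ} {c : Plane}

theorem norm_tangent (h : IsElastica β K c) {x : ℝ} (hx : x ∈ Icc (0 : ℝ) 1) :
    ‖tangent β x‖ = 1 := by
  rw [tangent, ds, ← dx, norm_smul, norm_inv, norm_norm,
    inv_mul_cancel₀ (norm_ne_zero_iff.mpr (h.regular x hx))]

theorem norm_normal (h : IsElastica β K c) {x : ℝ} (hx : x ∈ Icc (0 : ℝ) 1) :
    ‖normal β x‖ = 1 := by rw [normal, norm_rot, h.norm_tangent hx]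

theorem speed_pos (h : IsElastica β K c) {x : ℝ} (hx : x ∈ Icc (0 : ℝ) 1) : 0 < ‖dx β x‖ :=
  norm_pos_iff.mpr (h.regular x hx)

theorem ds_eq {V : Type*} [NormedAddCommGroup V] [NormedSpace ℝ V] (h : IsElastica β K c)
    {f g : ℝ → V} {x : ℝ} (hx : x ∈ Icc (0 : ℝ) 1)
    (hf : HasDerivWithinAt f (‖dx β x‖ • g x) (Icc 0 1) x) : ds β f x = g x := by
  rw [ds, hf.derivWithin (uniqueDiffWithinAt_unitInterval hx),
    inv_smul_smul₀ (h.speed_pos hx).ne']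

theorem ds_congr {V : Type*} [NormedAddCommGroup V] [NormedSpace ℝ V] {f g : ℝ → V} {x : ℝ}
    (hx : x ∈ Icc (0 : ℝ) 1) (hfg : ∀ y ∈ Icc (0 : ℝ) 1, f y = g y) : ds β f x = ds β g x := by
  rw [ds, ds, derivWithin_congr hfg (hfg x hx)]

theorem normal_deriv (h : IsElastica β K c) {x : ℝ} (hx : x ∈ Icc (0 : ℝ) 1) :
    HasDerivWithinAt (normal β) (‖dx β x‖ • -(K x • tangent β x)) (Icc 0 1) x := by
  have := rotL.hasFDerivAt.comp_hasDerivWithinAt x (h.tangent_deriv x hx)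
  refine this.congr_deriv ?_
  rw [map_smul, map_smul, rotL_apply, normal, rot_rot, smul_neg]

theorem curvatureVector_eq (h : IsElastica β K c) {x : ℝ} (hx : x ∈ Icc (0 : ℝ) 1) :
    curvatureVector β x = K x • normal β x :=
  h.ds_eq hx (g := fun x ↦ K x • normal β x) (h.tangent_deriv x hx)

theorem curvature_eq (h : IsElastica β K c) {x : ℝ} (hx : x ∈ Icc (0 : ℝ) 1) :
    curvature β x = K x := by
  rw [curvature, h.curvatureVector_eq hx, inner_smul_left, real_inner_self_eq_norm_sq,
    h.norm_normal hx]
  simp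

theorem inner_tangent_normal (β : ℝ → Plane) (x : ℝ) :
    inner ℝ (tangent β x) (normal β x) = 0 := inner_rot_self _

theorem inner_normal_tangent (β : ℝ → Plane) (x : ℝ) :
    inner ℝ (normal β x) (tangent β x) = 0 := by
  rw [real_inner_comm, inner_tangent_normal]

/-- Pairing the moment `2Kν` with `ν` recovers `K`, so `K` inherits differentiability from the
moment; its derivative is the normal component of the moment equation. -/
theorem curvature_deriv (h : IsElastica β K c) {x : ℝ} (hx : x ∈ Icc (0 : ℝ) 1) :
    HasDerivWithinAt K (‖dx β x‖ • (-inner ℝ c (normal β x) / 2)) (Icc 0 1) x := by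
  have h1 := (((h.moment_deriv x hx).inner ℝ (h.normal_deriv hx)).div_const 2)
  have h2 : ∀ y ∈ Icc (0 : ℝ) 1, K y = inner ℝ ((2 * K y) • normal β y) (normal β y) / 2 :=
    fun y hy ↦ by
      rw [inner_smul_left, real_inner_self_eq_norm_sq, h.norm_normal hy]
      simp
  refine (h1.congr h2 (h2 x hx)).congr_deriv ?_
  simp only [inner_smul_left, inner_smul_right, inner_neg_right, inner_sub_left,
    inner_normal_tangent, inner_tangent_normal, smul_eq_mul]
  simp
  ring

/-- The tangential component of the moment equation: differentiating `⟨2Kν, τ⟩ = 0` gives `2K² + (1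
- 3K²) - ⟨c, τ⟩ = 0` after division by the speed. -/
theorem inner_tangent_eq (h : IsElastica β K c) {x : ℝ} (hx : x ∈ Icc (0 : ℝ) 1) :
    K x ^ 2 + inner ℝ c (tangent β x) = 1 := by
  have h1 := (h.moment_deriv x hx).inner ℝ (h.tangent_deriv x hx)
  have h2 : ∀ y, (0 : ℝ) = inner ℝ ((2 * K y) • normal β y) (tangent β y) := fun y ↦ by
    rw [inner_smul_left, inner_normal_tangent, mul_zero]
  have h3 := (h1.congr (f₁ := fun _ ↦ (0 : ℝ)) (fun y _ ↦ h2 y) (h2 x)).derivWithin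
    (uniqueDiffWithinAt_unitInterval hx)
  have h4 := (h.speed_pos hx).ne'
  simp only [inner_smul_left, inner_smul_right, inner_sub_left, real_inner_self_eq_norm_sq,
    h.norm_tangent hx, h.norm_normal hx] at h3
  simp at h3
  have h5 : ‖dx β x‖ * (K x ^ 2 + inner ℝ c (tangent β x) - 1) = 0 := by linear_combination h3
  linarith [(mul_eq_zero.mp h5).resolve_left h4]

theorem ds_curvature (h : IsElastica β K c) {x : ℝ} (hx : x ∈ Icc (0 : ℝ) 1) :
    ds β (curvature β) x = -inner ℝ c (normal β x) / 2 := by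
  rw [ds_congr hx fun y hy ↦ h.curvature_eq hy]
  exact h.ds_eq hx (g := fun x ↦ -inner ℝ c (normal β x) / 2) (h.curvature_deriv hx)

theorem curvature_deriv_deriv (h : IsElastica β K c) {x : ℝ} (hx : x ∈ Icc (0 : ℝ) 1) :
    HasDerivWithinAt (fun x ↦ -inner ℝ c (normal β x) / 2)
      (‖dx β x‖ • ((K x - K x ^ 3) / 2)) (Icc 0 1) x := by
  refine (((hasDerivWithinAt_const x _ c).inner ℝ (h.normal_deriv hx)).neg.div_const
    2).congr_deriv ?_
  simp only [inner_smul_right, inner_neg_right, inner_zero_left, smul_eq_mul]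
  linear_combination (‖dx β x‖ * K x / 2) * h.inner_tangent_eq hx

theorem ds_ds_curvature (h : IsElastica β K c) {x : ℝ} (hx : x ∈ Icc (0 : ℝ) 1) :
    ds β (ds β (curvature β)) x = (K x - K x ^ 3) / 2 := by
  rw [ds_congr hx fun y hy ↦ h.ds_curvature hy]
  exact h.ds_eq hx (g := fun x ↦ (K x - K x ^ 3) / 2) (h.curvature_deriv_deriv hx)

/-- As `∂ₛν = -Kτ` is purely tangential, the normal projection sees only the derivative of the
coefficient. -/
theorem dsPerp_smul_normal (h : IsElastica β K c) {f f' : ℝ → ℝ} {X : ℝ → Plane}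
    (hX : ∀ y ∈ Icc (0 : ℝ) 1, X y = f y • normal β y) {x : ℝ} (hx : x ∈ Icc (0 : ℝ) 1)
    (hf : HasDerivWithinAt f (‖dx β x‖ • f' x) (Icc 0 1) x) :
    dsPerp β X x = f' x • normal β x := by
  have h1 : ds β X x = -(f x * K x) • tangent β x + f' x • normal β x := by
    rw [ds_congr hx hX]
    refine h.ds_eq hx (g := fun x ↦ -(f x * K x) • tangent β x + f' x • normal β x) ?_
    refine (hf.smul (h.normal_deriv hx)).congr_deriv ?_
    simp only [smul_eq_mul]
    module
  rw [dsPerp, h1, inner_add_left, inner_smul_left, inner_smul_left, inner_normal_tangent,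
    real_inner_self_eq_norm_sq, h.norm_tangent hx]
  simp

theorem dsPerp_dsPerp_curvatureVector (h : IsElastica β K c) {x : ℝ} (hx : x ∈ Icc (0 : ℝ) 1) :
    dsPerp β (dsPerp β (curvatureVector β)) x = ((K x - K x ^ 3) / 2) • normal β x :=
  h.dsPerp_smul_normal (f' := fun x ↦ (K x - K x ^ 3) / 2) (fun _ hy ↦ h.dsPerp_smul_normal
    (f' := fun x ↦ -inner ℝ c (normal β x) / 2) (fun _ hz ↦ h.curvatureVector_eq hz) hy
    (h.curvature_deriv hy)) hx (h.curvature_deriv_deriv hx)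

theorem euler_lagrange (h : IsElastica β K c) {x : ℝ} (hx : x ∈ Icc (0 : ℝ) 1) :
    (2 : ℝ) • dsPerp β (dsPerp β (curvatureVector β)) x
      + ‖curvatureVector β x‖ ^ 2 • curvatureVector β x - curvatureVector β x = 0 := by
  rw [h.dsPerp_dsPerp_curvatureVector hx, h.curvatureVector_eq hx, norm_smul, h.norm_normal hx,
    mul_one, Real.norm_eq_abs, sq_abs]
  module

/-- At a zero of `K` the conservation law fixes the tangential component of `c` to be `1`, and
Pythagoras determines the normal component up to sign. The right side does not depend on the point.
-/
theorem sq_ds_curvature (h : IsElastica β K c) {x : ℝ} (hx : x ∈ Icc (0 : ℝ) 1) (h0 : K x = 0) :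
    4 * ds β (curvature β) x ^ 2 = ‖c‖ ^ 2 - 1 := by
  have h1 := h.inner_tangent_eq hx
  have h2 := congrArg (fun v ↦ (inner ℝ c v : ℝ)) (eq_inner_smul_add (h.norm_tangent hx) c)
  simp only [inner_add_right, inner_smul_right, real_inner_self_eq_norm_sq] at h2
  have h3 : (inner ℝ c (tangent β x) : ℝ) = 1 := by simpa [h0] using h1
  rw [h3] at h2
  rw [h.ds_curvature hx, normal, h2]
  ring

theorem ds_curvature_endpoints (h : IsElastica β K c) :
    ds β (curvature β) 0 = ds β (curvature β) 1 ∨ ds β (curvature β) 0 = -ds β (curvature β) 1 := by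
  rw [← sq_eq_sq_iff_eq_or_eq_neg]
  have h0 := h.sq_ds_curvature (left_mem_Icc.mpr zero_le_one) h.zero
  have h1 := h.sq_ds_curvature (right_mem_Icc.mpr zero_le_one) h.one
  linarith

/-- An elastica parametrized with constant speed is smooth. -/
theorem contDiffOn (h : IsElastica β K c) {ℓ : ℝ} (hℓ : ∀ x ∈ Icc (0 : ℝ) 1, ‖dx β x‖ = ℓ) :
    ContDiffOn ℝ ∞ β (Icc 0 1) := by
  have hu : UniqueDiffOn ℝ (Icc (0 : ℝ) 1) := uniqueDiffOn_Icc zero_lt_one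
  have hrot : ∀ n : ℕ, ContDiffOn ℝ n (tangent β) (Icc 0 1) →
      ContDiffOn ℝ n (normal β) (Icc 0 1) := fun n hn ↦ rotL.contDiff.comp_contDiffOn hn
  -- The induction is joint because the system is coupled: `τ' = ℓKν` and `K' = -ℓ⟨c, ν⟩ / 2`.
  -- Constant speed removes `‖dx β‖`, the only coefficient whose smoothness is not known.
  have key : ∀ n : ℕ, ContDiffOn ℝ n (tangent β) (Icc 0 1) ∧ ContDiffOn ℝ n K (Icc 0 1) := by
    intro n
    induction n with
    | zero =>
      simp only [Nat.cast_zero, contDiffOn_zero]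
      exact ⟨fun x hx ↦ (h.tangent_deriv x hx).continuousWithinAt,
        fun x hx ↦ (h.curvature_deriv hx).continuousWithinAt⟩
    | succ n ih =>
      obtain ⟨h1, h2⟩ := ih
      simp only [Nat.cast_add, Nat.cast_one]
      rw [contDiffOn_succ_iff_derivWithin hu, contDiffOn_succ_iff_derivWithin hu]
      refine ⟨⟨fun x hx ↦ (h.tangent_deriv x hx).differentiableWithinAt, by simp, ?_⟩,
        fun x hx ↦ (h.curvature_deriv hx).differentiableWithinAt, by simp, ?_⟩
      · refine ((h2.smul (hrot n h1)).const_smul ℓ).congr fun x hx ↦ ?_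
        rw [(h.tangent_deriv x hx).derivWithin (hu x hx), hℓ x hx]
        rfl
      · refine ((((contDiffOn_const (c := c)).inner ℝ (hrot n h1)).neg.div_const
          2).const_smul ℓ).congr fun x hx ↦ ?_
        rw [(h.curvature_deriv hx).derivWithin (hu x hx), hℓ x hx]
  rw [contDiffOn_infty_iff_derivWithin hu]
  refine ⟨h.differentiable, contDiffOn_infty.mpr fun n ↦ ((key n).1.const_smul ℓ).congr
    fun x hx ↦ ?_⟩
  rw [tangent, ds, hℓ x hx, smul_inv_smul₀]
  exact hℓ x hx ▸ (h.speed_pos hx).ne'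

end IsElastica

end Elastica

end ElasticDrop

theorem mainTheorem3 (γ : ℝ → ElasticDrop.Plane)
    (hdrop : ElasticDrop.IsDrop γ) (hstat : ElasticDrop.IsStationary γ) :
    (∃ η : ℝ → ElasticDrop.Plane, ElasticDrop.IsSmoothParametrization γ η) ∧
    ∀ η : ℝ → ElasticDrop.Plane, ElasticDrop.IsSmoothParametrization γ η →
      (∀ x ∈ Set.Ioo (0 : ℝ) 1,
        (2 : ℝ) • ElasticDrop.dsPerp η (ElasticDrop.dsPerp η (ElasticDrop.curvatureVector η)) x
          + ‖ElasticDrop.curvatureVector η x‖ ^ 2 • ElasticDrop.curvatureVector η x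
          - ElasticDrop.curvatureVector η x = 0) ∧
      (∀ x ∈ Set.Icc (0 : ℝ) 1,
        2 * ElasticDrop.ds η (ElasticDrop.ds η (ElasticDrop.curvature η)) x
          + ElasticDrop.curvature η x ^ 3 - ElasticDrop.curvature η x = 0) ∧
      ElasticDrop.curvature η 0 = 0 ∧ ElasticDrop.curvature η 1 = 0 ∧
      (ElasticDrop.ds η (ElasticDrop.curvature η) 0
          = ElasticDrop.ds η (ElasticDrop.curvature η) 1 ∨
        ElasticDrop.ds η (ElasticDrop.curvature η) 0
          = -ElasticDrop.ds η (ElasticDrop.curvature η) 1) := by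
  obtain ⟨K, c, h⟩ := hdrop.exists_isElastica hstat
  refine ⟨?_, fun η hη ↦ ?_⟩
  · obtain ⟨φ, θ, hφ, hθ, hl, ℓ, -, hspeed⟩ :=
      ElasticDrop.exists_constant_speed h.differentiable h.continuousOn_dx h.regular
    have hη := h.reparam hθ (η := fun y ↦ γ (θ y)) fun _ _ ↦ rfl
    exact ⟨_, hη.contDiffOn hspeed, hη.regular, φ, hφ, fun x hx ↦ by simp only [hl x hx]⟩
  · obtain ⟨φ, hφ, hγ⟩ := hη.reparam
    obtain ⟨θ, hθ, -, hr⟩ := hφ.exists_inverse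
    -- Here `η = γ ∘ θ` with `θ` the inverse of the given change of parameter, so the system passes
    -- from `γ` to an arbitrary smooth parametrization.
    have he := h.reparam hθ (η := η) fun y hy ↦ by rw [hγ _ (hθ.mapsTo hy), hr y hy]
    refine ⟨fun x hx ↦ he.euler_lagrange (Ioo_subset_Icc_self hx), fun x hx ↦ ?_, ?_, ?_,
      he.ds_curvature_endpoints⟩
    · rw [he.ds_ds_curvature hx, he.curvature_eq hx]
      ring
    · rw [he.curvature_eq (left_mem_Icc.mpr zero_le_one), he.zero]
    · rw [he.curvature_eq (right_mem_Icc.mpr zero_le_one), he.one]
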